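/- Let space-time be $\mathbb R\times\mathbb R^3$ with inertial Cartesian coordinates $(x^0,x^1,x^2,x^3)=(t,\mathbf x)$, speed of light $1$, metric $g=\mathrm{diag}(-1,1,1,1)$, and let $\mathbf b_\mu$ ($\mathbf b^\mu=g^{\mu\nu}\mathbf b_\nu$) be the basis vectors of its real Clifford algebra, $\tfrac12(\mathbf b_\mu\mathbf b_\nu+\mathbf b_\nu\mathbf b_\mu)=g_{\mu\nu}\mathbf 1$. For vectors $\mathbf a,\mathbf c$ put $\mathbf a\wedge\mathbf c=\tfrac12(\mathbf a\mathbf c-\mathbf c\mathbf a)$, and let $\imath=\mathbf b^0\mathbf b^1\mathbf b^2\mathbf b^3$ be the unit pseudoscalar. A spatial vector $v$ is identified with $v^i\mathbf b_i$. Derivatives, and integrals containing delta functions, are understood in the sense of distributions; $\boldsymbol\partial=\mathbf b^\mu\partial_\mu$. Let $e,m\in\mathbb R$ be constant electric and magnetic charges, and let $r:\mathbb R\to\mathbb R^3$ be a $C^2$ trajectory with velocity $u=\dot r$, $|u(t)|<1$ for all $t$, and acceleration $\dot u$. The current density of the point dyon is $\mathbf j=\mathbf j_e+\imath\,\mathbf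 j_m=(e\mathbf 1+\imath m)(\mathbf b_0+u(t))\,\delta^3(\mathbf x-r(t))$, with $\mathbf j_e=e(\mathbf b_0+u(t))\,\delta^3(\mathbf x-r(t))$ and $\mathbf j_m=m(\mathbf b_0+u(t))\,\delta^3(\mathbf x-r(t))$. For an event $(t,\mathbf x)$, a retarded time $t_r$ and an advanced time $t_a$ are solutions of $t_r=t-|\mathbf x-r(t_r)|$ and $t_a=t+|\mathbf x-r(t_a)|$. Let $\Omega$ be the set of events that have both. Then: (i) On $\Omega$ the times $t_r$ and $t_a$ are unique; $\Omega$ is open; and $\Omega$ is all of space-time if $|u|\le\kappa$ for some constant $\kappa<1$. (ii) Let $R(s)=\mathbf x-r(s)$. The function $$\mathbf F(t,\mathbf x)=\tfrac12(e\mathbf 1-\imath m)\Big\{\Big[\frac{1-|u|^2+R\cdot\dot u}{(|R|-R\cdot u)^{3}}\big(R\wedge\mathbf b^0-|R|\,u\wedge\mathbf b^0-R\wedge u\big)-\frac{|R|\,\dot u\wedge\mathbf b^0+R\wedge\dot u}{(|R|-R\cdot u)^{2}}\Big]_{s=t_r}$$ $$\qquad+\Big[\frac{1-|u|^2+R\cdot\dot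 u}{(|R|+R\cdot u)^{3}}\big(R\wedge\mathbf b^0+|R|\,u\wedge\mathbf b^0-R\wedge u\big)-\frac{|R|\,\dot u\wedge\mathbf b^0-R\wedge\dot u}{(|R|+R\cdot u)^{2}}\Big]_{s=t_a}\Big\},$$ where $R,u,\dot u$ are evaluated at the time $s$ and the dot is the Euclidean scalar product, is locally integrable on $\Omega$ and continuous on $\Omega$ off the world line $\{\mathbf x=r(t)\}$. (iii) On $\Omega$, in the sense of distributions, $\mathbf F$ is the field produced by the source function $\mathbf S=-\boldsymbol\partial\,\delta(x^\mu x_\mu)$, where $\delta(x^\mu x_\mu)=\frac{1}{2|\mathbf x|}[\delta(x^0-|\mathbf x|)+\delta(x^0+|\mathbf x|)]$, that is, $$\mathbf F(z)=\int\big[\mathbf S(x-z)\wedge\mathbf j_e(x)-\imath\,\mathbf S(x-z)\wedge\mathbf j_m(x)\big]\,d^4x ,$$ and $\mathbf F$ solves the Maxwell equation $\boldsymbol\partial\,\mathbf F=-4\pi\,\mathbf j$. -/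

import Mathlib

open scoped ContDiff
open MeasureTheory

noncomputable section

namespace Dyon

/-- Euclidean three-space. -/
abbrev Space : Type := EuclideanSpace ℝ (Fin 3)

/-- Space-time in inertial Cartesian coordinates `(t, x)` with the speed of light equal to one;
its measure is `dt dx¹ dx² dx³`. -/
abbrev Event : Type := ℝ × Space

/-- The Minkowski form of signature `(-,+,+,+)`. -/
def minkowski : QuadraticForm ℝ Event :=
  QuadraticMap.prod (-QuadraticMap.sq) (LinearMap.BilinMap.toQuadraticMap (innerₗ Space))

theorem minkowski_apply (z : Event) : minkowski z = -(z.1 * z.1) + ‖z.2‖ ^ 2 := by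
  simp [minkowski]

/-- Clifford numbers of Minkowski space-time. -/
abbrev Cl : Type := CliffordAlgebra minkowski

/-- The coordinate directions of space-time. -/
def dir : Fin 4 → Event :=
  ![(1, 0), (0, EuclideanSpace.single 0 1), (0, EuclideanSpace.single 1 1),
    (0, EuclideanSpace.single 2 1)]

/-- The diagonal entries of the metric, `-1, 1, 1, 1`. -/
def metricDiag : Fin 4 → ℝ := ![-1, 1, 1, 1]

/-- The basis vectors with lower index. -/
def bLow (μ : Fin 4) : Cl := CliffordAlgebra.ι minkowski (dir μ)

/-- The basis vectors with upper index: in particular `bUp 0 = - bLow 0`. -/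
def bUp (μ : Fin 4) : Cl := metricDiag μ • bLow μ

/-- A spatial vector as a Clifford number. -/
def vec (v : Space) : Cl := CliffordAlgebra.ι minkowski (0, v)

/-- The unit pseudoscalar (Clifford imaginary unit). -/
def im : Cl := bUp 0 * bUp 1 * bUp 2 * bUp 3

/-- The exterior (antisymmetric) product of two vectors. -/
def wedge (a b : Cl) : Cl := (1 / 2 : ℝ) • (a * b - b * a)

/-- Partial derivative with respect to the coordinate `μ`. -/
def pd (μ : Fin 4) (f : Event → ℝ) (z : Event) : ℝ := fderiv ℝ f z (dir μ)

/-- Smooth test functions with compact support contained in `U`. -/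
def IsTestFunction (U : Set Event) (φ : Event → ℝ) : Prop :=
  ContDiff ℝ ∞ φ ∧ HasCompactSupport φ ∧ tsupport φ ⊆ U

/-- `a` is the integral of the Clifford-valued function `f`: every real linear component of `f`
is integrable, with integral the corresponding component of `a`. -/
def HasIntegral {α : Type*} [MeasurableSpace α] (μ : Measure α) (f : α → Cl) (a : Cl) : Prop :=
  ∀ ℓ : Module.Dual ℝ Cl, Integrable (fun x => ℓ (f x)) μ ∧ ∫ x, ℓ (f x) ∂μ = ℓ a

/-- The distribution `δ(x^μ x_μ) = (δ(t - |x|) + δ(t + |x|)) / (2 |x|)`. -/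
def deltaCone (ψ : Event → ℝ) : ℝ :=
  ∫ x : Space, (2 * ‖x‖)⁻¹ * (ψ (‖x‖, x) + ψ (-‖x‖, x))

/-- The source function `S = - b^μ ∂_μ δ(x^ν x_ν)`, a vector-valued distribution. -/
def source (ψ : Event → ℝ) : Cl := ∑ μ : Fin 4, deltaCone (pd μ ψ) • bUp μ

/-- The pairing `∫ S(x - z) φ(z) dz`, as a function of `x`. -/
def sourceAt (φ : Event → ℝ) (x : Event) : Cl := source (fun y => φ (x - y))

/-- `b_0 + u`, where `u` is the velocity at time `s` on the trajectory `r`. -/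
def flow (r : ℝ → Space) (s : ℝ) : Cl := bLow 0 + vec (deriv r s)

/-- `d = ⟨j, φ⟩`, where `j = (e + ı m) (b_0 + u(t)) δ³(x - r(t))` is the current density of a
point dyon with charges `e`, `m` and trajectory `r`. -/
def IsCurrentPairing (e m : ℝ) (r : ℝ → Space) (φ : Event → ℝ) (d : Cl) : Prop :=
  HasIntegral volume
    (fun s : ℝ => φ (s, r s) • ((e • (1 : Cl) + m • im) * flow r s)) d

/-- `a = ⟨F, φ⟩`, where
`F(z) = ∫ [S(x - z) ∧ j_e(x) - ı (S(x - z) ∧ j_m(x))] d⁴x`, and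
`j_e = e (b_0 + u(t)) δ³(x - r(t))`, `j_m = m (b_0 + u(t)) δ³(x - r(t))`
are the electric and magnetic current densities of the dyon. -/
def IsSourceFieldPairing (e m : ℝ) (r : ℝ → Space) (φ : Event → ℝ) (a : Cl) : Prop :=
  HasIntegral volume
    (fun s : ℝ => wedge (sourceAt φ (s, r s)) (e • flow r s)
      - im * wedge (sourceAt φ (s, r s)) (m • flow r s)) a

/-- The distributional Dirac derivative of a Clifford-valued function:
`c = ⟨b^μ ∂_μ F, φ⟩ = - ∫ b^μ F ∂_μ φ`. -/
def IsDiracPairing (F : Event → Cl) (φ : Event → ℝ) (c : Cl) : Prop :=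
  HasIntegral volume (fun z : Event => -∑ μ : Fin 4, pd μ φ z • (bUp μ * F z)) c

/-- `s` is a retarded time of the event `z`. -/
def IsRetardedTime (r : ℝ → Space) (z : Event) (s : ℝ) : Prop := s = z.1 - ‖z.2 - r s‖

/-- `s` is an advanced time of the event `z`. -/
def IsAdvancedTime (r : ℝ → Space) (z : Event) (s : ℝ) : Prop := s = z.1 + ‖z.2 - r s‖

/-- The events that have both a retarded and an advanced time. -/
def domain (r : ℝ → Space) : Set Event :=
  {z | (∃ s, IsRetardedTime r z s) ∧ ∃ s, IsAdvancedTime r z s}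

/-- The retarded expression, with trajectory, velocity and acceleration taken at time `s`. -/
def retardedPart (r : ℝ → Space) (x : Space) (s : ℝ) : Cl :=
  let R : Space := x - r s
  let u : Space := deriv r s
  let a : Space := deriv (deriv r) s
  let k : ℝ := ‖R‖ - inner ℝ R u
  ((k ^ 3)⁻¹ * (1 - ‖u‖ ^ 2 + inner ℝ R a)) •
      (wedge (vec R) (bUp 0) - ‖R‖ • wedge (vec u) (bUp 0) - wedge (vec R) (vec u))
    - (k ^ 2)⁻¹ • (‖R‖ • wedge (vec a) (bUp 0) + wedge (vec R) (vec a))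

/-- The advanced expression, with trajectory, velocity and acceleration taken at time `s`. -/
def advancedPart (r : ℝ → Space) (x : Space) (s : ℝ) : Cl :=
  let R : Space := x - r s
  let u : Space := deriv r s
  let a : Space := deriv (deriv r) s
  let k : ℝ := ‖R‖ + inner ℝ R u
  ((k ^ 3)⁻¹ * (1 - ‖u‖ ^ 2 + inner ℝ R a)) •
      (wedge (vec R) (bUp 0) + ‖R‖ • wedge (vec u) (bUp 0) - wedge (vec R) (vec u))
    - (k ^ 2)⁻¹ • (‖R‖ • wedge (vec a) (bUp 0) - wedge (vec R) (vec a))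

/-- The field of the dyon at `z`, given a retarded time `tr z` and an advanced time `ta z`. -/
def dyonField (e m : ℝ) (r : ℝ → Space) (tr ta : Event → ℝ) (z : Event) : Cl :=
  (1 / 2 : ℝ) • ((e • (1 : Cl) - m • im) *
    (retardedPart r z.2 (tr z) + advancedPart r z.2 (ta z)))

end Dyon

end

noncomputable section

namespace Dyon

open Filter Topology Set

/-! Fix a sign `σ` (`1` retarded, `-1` advanced). The coordinates (s, y) ↦ (s + σ|y|, r(s) + y)
attach to each event the point s of the trajectory from which it is seen along a light cone. Since
the speed is below 1, s + σ|x - r(s)| is strictly increasing in s. Hence the cone times are unique,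
they depend continuously on the event, and the coordinates are injective. With k = |y| - σ y·u, the
Jacobian is k/|y|. In these coordinates each singularity is a power of |y| on the axis y = 0, which
has codimension 3. So |y|⁻² is locally integrable, and integration by parts of an |y|⁻¹ singularity
leaves no boundary term, because almost every line misses the axis.

In cone coordinates ∂_s acts on a test function as ∂_t + u·∇, and ∂_y acts as ∇ + σ(y/|y|)∂_t, so
∂_t = (|y|/k)(∂_s - u·∂_y). Integrating by parts with this formula turns the pairing of the source
with the current into the pairing of the explicit field with φ; the pointwise identity is
`field_algebra`, the integrated form `integral_field`.

For the Maxwell equation, write b^μ(b^ν ∧ j) = b^μ b^ν j - (b^ν·j) b^μ. Second derivatives are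
symmetric, so b^μ b^ν ∂_μ∂_ν is the scalar wave operator, and `coneMean_wave` gives -4π at the
vertex for each half cone. The other term is the derivative of the cone potential along the current.
It integrates to zero (`integral_coneMean_current`), which is charge conservation. Finally the
pseudoscalar anticommutes with vectors, so the prefactor e - ım of the field becomes the factor e +
ım of the current. -/

section

/-- `s` is the time at which the trajectory meets the past (`σ = 1`) or future (`σ = -1`)
light cone of the event `z`. -/
def IsConeTime (σ : ℝ) (r : ℝ → Space) (z : Event) (s : ℝ) : Prop :=
  s + σ * ‖z.2 - r s‖ = z.1

theorem isRetardedTime_iff {r : ℝ → Space} {z : Event} {s : ℝ} :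
    IsRetardedTime r z s ↔ IsConeTime 1 r z s := by
  unfold IsRetardedTime IsConeTime
  constructor <;> intro h <;> linarith

theorem isAdvancedTime_iff {r : ℝ → Space} {z : Event} {s : ℝ} :
    IsAdvancedTime r z s ↔ IsConeTime (-1) r z s := by
  unfold IsAdvancedTime IsConeTime
  constructor <;> intro h <;> linarith

/-! ### Light-cone times and light-cone coordinates. -/

section Geometry

variable {r : ℝ → Space}

/-- The continuous speed attains its maximum on [s, t]. This maximum is below 1, so the mean value
inequality becomes strict. -/
theorem norm_sub_lt (hr : ContDiff ℝ 2 r) (hsub : ∀ t, ‖deriv r t‖ < 1) {s t : ℝ} (h : s < t) :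
    ‖r t - r s‖ < t - s := by
  have hc : Continuous (deriv r) := hr.continuous_deriv (by norm_num)
  obtain ⟨x, -, hx⟩ := (isCompact_Icc (a := s) (b := t)).exists_isMaxOn
    (nonempty_Icc.2 h.le) hc.norm.continuousOn
  have := (convex_Icc s t).norm_image_sub_le_of_norm_deriv_le (f := r) (C := ‖deriv r x‖)
    (fun y _ => (hr.differentiable (by norm_num)).differentiableAt) (fun y hy => hx hy)
    (left_mem_Icc.2 h.le) (right_mem_Icc.2 h.le)
  rw [Real.norm_of_nonneg (by linarith : 0 ≤ t - s)] at this
  nlinarith [hsub x]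

variable {σ : ℝ}

theorem coneTime_strictMono (hr : ContDiff ℝ 2 r) (hsub : ∀ t, ‖deriv r t‖ < 1)
    (hσ : σ = 1 ∨ σ = -1) (x : Space) : StrictMono fun s => s + σ * ‖x - r s‖ := by
  intro s t h
  have h1 := norm_sub_lt hr hsub h
  have h2 : |‖x - r s‖ - ‖x - r t‖| ≤ ‖r t - r s‖ := by
    simpa using abs_norm_sub_norm_le (x - r s) (x - r t)
  have h3 := abs_le.1 h2
  rcases hσ with rfl | rfl <;> dsimp only <;> linarith

theorem IsConeTime.unique (hr : ContDiff ℝ 2 r) (hsub : ∀ t, ‖deriv r t‖ < 1)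
    (hσ : σ = 1 ∨ σ = -1) {z : Event} {s t : ℝ} (hs : IsConeTime σ r z s)
    (ht : IsConeTime σ r z t) : s = t :=
  (coneTime_strictMono hr hsub hσ z.2).injective (hs.trans ht.symm)

/-- By strict monotonicity the values at s ± ε lie strictly on either side of the time of the event.
This persists for nearby events, and the intermediate value theorem supplies their cone times.
Openness of the domain and continuity of the cone time both follow. -/
theorem IsConeTime.eventually (hr : ContDiff ℝ 2 r) (hsub : ∀ t, ‖deriv r t‖ < 1)
    (hσ : σ = 1 ∨ σ = -1) {z : Event} {s : ℝ} (hs : IsConeTime σ r z s) {ε : ℝ} (hε : 0 < ε) :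
    ∀ᶠ z' in 𝓝 z, ∃ s', |s' - s| < ε ∧ IsConeTime σ r z' s' := by
  have hm := coneTime_strictMono hr hsub hσ z.2
  have h1 : s - ε + σ * ‖z.2 - r (s - ε)‖ < z.1 := by
    rw [← show s + σ * ‖z.2 - r s‖ = z.1 from hs]; exact hm (by linarith)
  have h2 : z.1 < s + ε + σ * ‖z.2 - r (s + ε)‖ := by
    rw [← show s + σ * ‖z.2 - r s‖ = z.1 from hs]; exact hm (by linarith)
  have e1 : ∀ᶠ z' : Event in 𝓝 z, s - ε + σ * ‖z'.2 - r (s - ε)‖ < z'.1 :=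
    (Continuous.continuousAt (by fun_prop)).eventually_lt (Continuous.continuousAt (by fun_prop)) h1
  have e2 : ∀ᶠ z' : Event in 𝓝 z, z'.1 < s + ε + σ * ‖z'.2 - r (s + ε)‖ :=
    (Continuous.continuousAt (by fun_prop)).eventually_lt (Continuous.continuousAt (by fun_prop)) h2
  filter_upwards [e1, e2] with z' a b
  have hrc := hr.continuous
  obtain ⟨s', hs', h'⟩ := intermediate_value_Ioo (by linarith : s - ε ≤ s + ε)
    (f := fun s => s + σ * ‖z'.2 - r s‖) (Continuous.continuousOn (by fun_prop)) ⟨a, b⟩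
  exact ⟨s', abs_lt.2 ⟨by linarith [hs'.1], by linarith [hs'.2]⟩, h'⟩

theorem isOpen_setOf_exists_isConeTime (hr : ContDiff ℝ 2 r) (hsub : ∀ t, ‖deriv r t‖ < 1)
    (hσ : σ = 1 ∨ σ = -1) : IsOpen {z | ∃ s, IsConeTime σ r z s} := by
  rw [isOpen_iff_mem_nhds]
  rintro z ⟨s, hs⟩
  filter_upwards [hs.eventually hr hsub hσ one_pos] with z' ⟨s', _, h⟩
  exact ⟨s', h⟩

theorem continuousOn_coneTime (hr : ContDiff ℝ 2 r) (hsub : ∀ t, ‖deriv r t‖ < 1)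
    (hσ : σ = 1 ∨ σ = -1) {U : Set Event} {τ : Event → ℝ}
    (hU : IsOpen U) (hτ : ∀ z ∈ U, IsConeTime σ r z (τ z)) : ContinuousOn τ U := by
  intro z hz
  refine ContinuousAt.continuousWithinAt ?_
  rw [Metric.continuousAt_iff']
  intro ε hε
  filter_upwards [(hτ z hz).eventually hr hsub hσ hε, hU.mem_nhds hz] with z' ⟨s', h1, h2⟩ hz'
  rw [Real.dist_eq, (hτ z' hz').unique hr hsub hσ h2]
  exact h1

theorem exists_isConeTime_of_le (hr : ContDiff ℝ 2 r) (hσ : σ = 1 ∨ σ = -1) {κ : ℝ}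
    (hκ : κ < 1) (h : ∀ t, ‖deriv r t‖ ≤ κ) (z : Event) : ∃ s, IsConeTime σ r z s := by
  have hb : ∀ s, ‖z.2 - r s‖ ≤ ‖z.2 - r 0‖ + κ * |s| := fun s => by
    have := convex_univ.norm_image_sub_le_of_norm_deriv_le (f := r) (C := κ) (x := 0) (y := s)
      (fun y _ => (hr.differentiable (by norm_num)).differentiableAt) (fun y _ => h y)
      (mem_univ _) (mem_univ _)
    rw [sub_zero, Real.norm_eq_abs] at this
    have h2 : z.2 - r s = (z.2 - r 0) - (r s - r 0) := by abel
    rw [h2]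
    exact (norm_sub_le _ _).trans (by linarith)
  -- Since |x - r(s)| ≤ |x - r(0)| + κ|s|, this is the |s| beyond which |s| - |x - r(s)| is at least
  -- |t|.
  set A := (|z.1| + ‖z.2 - r 0‖) / (1 - κ) with hA
  have hk : 0 < 1 - κ := by linarith
  have hA0 : 0 ≤ A := by positivity
  have hAe : A * (1 - κ) = |z.1| + ‖z.2 - r 0‖ := by rw [hA]; field_simp
  have b1 := hb A
  have b2 := hb (-A)
  rw [abs_neg] at b2
  rw [abs_of_nonneg hA0] at b1 b2
  have hrc := hr.continuous
  have n1 := norm_nonneg (z.2 - r A)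
  have n2 := norm_nonneg (z.2 - r (-A))
  have z1 := neg_abs_le z.1
  have z2 := le_abs_self z.1
  obtain ⟨s, -, hs⟩ := intermediate_value_Icc (by linarith : -A ≤ A)
    (f := fun s => s + σ * ‖z.2 - r s‖) (Continuous.continuousOn (by fun_prop))
    (show z.1 ∈ _ by
      rcases hσ with rfl | rfl <;> constructor <;> nlinarith)
  exact ⟨s, hs⟩

/-- Light-cone coordinates along the trajectory. -/
def coneMap (σ : ℝ) (r : ℝ → Space) (q : Event) : Event := (q.1 + σ * ‖q.2‖, r q.1 + q.2)

theorem isConeTime_coneMap (q : Event) : IsConeTime σ r (coneMap σ r q) q.1 := by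
  simp [IsConeTime, coneMap]

theorem continuous_coneMap (hr : ContDiff ℝ 2 r) : Continuous (coneMap σ r) := by
  have := hr.continuous
  unfold coneMap
  fun_prop

theorem coneMap_injective (hr : ContDiff ℝ 2 r) (hsub : ∀ t, ‖deriv r t‖ < 1)
    (hσ : σ = 1 ∨ σ = -1) : Function.Injective (coneMap σ r) := by
  intro p q h
  have h1 : p.1 = q.1 :=
    (isConeTime_coneMap p).unique hr hsub hσ (h ▸ isConeTime_coneMap q)
  have h2 := congrArg Prod.snd h
  simp only [coneMap, h1, add_right_inj] at h2
  exact Prod.ext h1 h2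

theorem coneMap_of_isConeTime {z : Event} {s : ℝ} (h : IsConeTime σ r z s) :
    coneMap σ r (s, z.2 - r s) = z := by
  refine Prod.ext ?_ ?_
  · exact h
  · simp [coneMap]

theorem isConeTime_sub_ne_zero {z : Event} {s : ℝ} (h : IsConeTime σ r z s)
    (hz : z.2 ≠ r z.1) : z.2 - r s ≠ 0 := by
  intro h0
  have : s = z.1 := by simpa [IsConeTime, h0] using h
  exact hz (by rw [← this]; exact sub_eq_zero.1 h0)

/-- Compact sets of events have bounded light-cone coordinates. -/
theorem exists_bound_of_coneMap_mem (hr : ContDiff ℝ 2 r) (hsub : ∀ t, ‖deriv r t‖ < 1)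
    (hσ : σ = 1 ∨ σ = -1) {U K : Set Event} {τ : Event → ℝ}
    (hU : IsOpen U) (hτ : ∀ z ∈ U, IsConeTime σ r z (τ z)) (hK : IsCompact K) (hKU : K ⊆ U) :
    ∃ A : ℝ, ∀ q, coneMap σ r q ∈ K → |q.1| ≤ A ∧ ‖q.2‖ ≤ A := by
  have hτc := (continuousOn_coneTime hr hsub hσ hU hτ).mono hKU
  have hrc := hr.continuous
  obtain ⟨A, hA⟩ := hK.exists_bound_of_continuousOn hτc
  have h2 : ContinuousOn (fun z : Event => z.2 - r (τ z)) K :=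
    continuousOn_snd.sub (hrc.comp_continuousOn hτc)
  obtain ⟨B, hB⟩ := hK.exists_bound_of_continuousOn h2
  refine ⟨max A B, fun q hq => ?_⟩
  have hs : τ (coneMap σ r q) = q.1 :=
    (hτ _ (hKU hq)).unique hr hsub hσ (isConeTime_coneMap q)
  have a := hA _ hq
  have b := hB _ hq
  rw [hs] at a b
  simp only [coneMap, add_sub_cancel_left] at b
  exact ⟨a.trans (le_max_left _ _), b.trans (le_max_right _ _)⟩

end Geometry

end

/-! ### Integrals of derivatives with singularities on the axis; growth classes. -/

section

/-- The integral of a directional derivative vanishes, if the function and its derivative are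
integrable and almost every line in the given direction is regular. -/
theorem integral_eq_zero_of_hasDerivAt_line {E : Type*} [NormedAddCommGroup E] [NormedSpace ℝ E]
    [MeasurableSpace E] [BorelSpace E] [FiniteDimensional ℝ E] (μ : Measure E)
    [μ.IsAddHaarMeasure] {g g' : E → ℝ} {v : E} (hg : Integrable g μ) (hg' : Integrable g' μ)
    (h : ∀ᵐ y ∂μ, ∀ t : ℝ, HasDerivAt (fun t : ℝ => g (y + t • v)) (g' (y + t • v)) t) :
    ∫ y, g' y ∂μ = 0 := by
  set ν : Measure ℝ := volume.restrict (Ioc 0 1) with hν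
  have hmp : MeasurePreserving (fun p : ℝ × E => (p.1, p.2 + p.1 • v)) (ν.prod μ) (ν.prod μ) :=
    (MeasurePreserving.id ν).skew_product (g := fun (t : ℝ) (y : E) => y + t • v)
      (by fun_prop) (Eventually.of_forall fun t => (measurePreserving_add_right μ (t • v)).map_eq)
  have hint : Integrable (fun p : ℝ × E => g' (p.2 + p.1 • v)) (ν.prod μ) :=
    hmp.integrable_comp_of_integrable (hg'.comp_snd ν)
  have hswap : Integrable (fun p : E × ℝ => g' (p.1 + p.2 • v)) (μ.prod ν) := hint.swap
  -- The same double integral over E × (0, 1] is computed in two orders. Along lines it is the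
  -- integral of g(y + v) - g(y), which vanishes by translation invariance; integrating over E first
  -- gives ∫ g'.
  have h1 : ∫ p : E × ℝ, g' (p.1 + p.2 • v) ∂(μ.prod ν) = 0 := by
    rw [integral_prod _ hswap]
    have : ∀ᵐ y ∂μ, ∫ t, g' (y + t • v) ∂ν = g (y + v) - g y := by
      filter_upwards [h, hswap.prod_right_ae] with y hy hi
      have hi' : IntervalIntegrable (fun t : ℝ => g' (y + t • v)) volume 0 1 :=
        (intervalIntegrable_iff_integrableOn_Ioc_of_le zero_le_one).2 hi
      have := intervalIntegral.integral_eq_sub_of_hasDerivAt (fun t _ => hy t) hi'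
      rw [intervalIntegral.integral_of_le zero_le_one] at this
      simpa using this
    rw [integral_congr_ae this, integral_sub (hg.comp_add_right v) hg, integral_add_right_eq_self,
      sub_self]
  have h2 : ∫ p : E × ℝ, g' (p.1 + p.2 • v) ∂(μ.prod ν) = ∫ y, g' y ∂μ := by
    rw [integral_prod_symm _ hswap]
    simp [integral_add_right_eq_self g', hν]
  rw [← h2, h1]

instance : (volume : Measure Event).IsAddHaarMeasure :=
  Measure.prod.instIsAddHaarMeasure volume volume

theorem finrank_space : Module.finrank ℝ Space = 3 := by simp

/-- Almost every line of a given direction avoids a subspace of codimension three. -/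
theorem ae_forall_snd_ne_zero (v : Event) :
    ∀ᵐ q : Event, ∀ t : ℝ, (q + t • v).2 ≠ 0 := by
  -- A line in direction v meets the axis only if it starts in this subspace. It is proper, because
  -- one vector cannot span three-space, and hence null.
  set S : Submodule ℝ Event := (Submodule.span ℝ {v.2}).comap (LinearMap.snd ℝ ℝ Space)
  have hS : S ≠ ⊤ := by
    intro h
    have h1 : Submodule.span ℝ {v.2} = ⊤ := by
      rw [eq_top_iff]
      intro y _
      have : ((0 : ℝ), y) ∈ S := h ▸ Submodule.mem_top
      simpa [S] using this
    have h2 := finrank_span_le_card (R := ℝ) ({v.2} : Set Space)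
    rw [h1, finrank_top, finrank_space] at h2
    simp at h2
  have h0 := Measure.addHaar_submodule (volume : Measure Event) S hS
  rw [measure_eq_zero_iff_ae_notMem] at h0
  filter_upwards [h0] with q hq t ht
  apply hq
  simp only [S, Submodule.mem_comap, LinearMap.snd_apply, SetLike.mem_coe]
  rw [Submodule.mem_span_singleton]
  refine ⟨-t, ?_⟩
  have : q.2 + t • v.2 = 0 := ht
  rw [neg_smul]
  exact (eq_neg_of_add_eq_zero_left this).symm

theorem ae_forall_add_smul_ne_zero (v : Space) :
    ∀ᵐ y : Space, ∀ t : ℝ, y + t • v ≠ 0 := by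
  set S : Submodule ℝ Space := (Submodule.span ℝ {v})
  have hS : S ≠ ⊤ := by
    intro h1
    have h2 := finrank_span_le_card (R := ℝ) ({v} : Set Space)
    rw [show Submodule.span ℝ {v} = ⊤ from h1, finrank_top, finrank_space] at h2
    simp at h2
  have h0 := Measure.addHaar_submodule (volume : Measure Space) S hS
  rw [measure_eq_zero_iff_ae_notMem] at h0
  filter_upwards [h0] with q hq t ht
  apply hq
  simp only [S, SetLike.mem_coe]
  rw [Submodule.mem_span_singleton]
  refine ⟨-t, ?_⟩
  rw [neg_smul]
  exact (eq_neg_of_add_eq_zero_left ht).symm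

/-- `f` is continuous off the axis `y = 0` and locally bounded by a multiple of `‖y‖ ^ d`. -/
structure Growth (d : ℤ) (f : Event → ℝ) : Prop where
  cont : ContinuousOn f {q | q.2 ≠ 0}
  bound : ∀ A : ℝ, ∃ C : ℝ, 0 ≤ C ∧ ∀ q : Event, q.2 ≠ 0 → |q.1| ≤ A → ‖q.2‖ ≤ A →
    |f q| ≤ C * ‖q.2‖ ^ d

namespace Growth

variable {d d₁ d₂ : ℤ} {f g : Event → ℝ}

theorem mul (hf : Growth d₁ f) (hg : Growth d₂ g) : Growth (d₁ + d₂) fun q => f q * g q := by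
  refine ⟨hf.cont.mul hg.cont, fun A => ?_⟩
  obtain ⟨C, hC, h1⟩ := hf.bound A
  obtain ⟨D, hD, h2⟩ := hg.bound A
  refine ⟨C * D, by positivity, fun q hq ha hb => ?_⟩
  rw [abs_mul, zpow_add₀ (norm_ne_zero_iff.2 hq)]
  calc |f q| * |g q| ≤ (C * ‖q.2‖ ^ d₁) * (D * ‖q.2‖ ^ d₂) := by
        gcongr
        · exact h1 q hq ha hb
        · exact h2 q hq ha hb
    _ = _ := by ring

theorem add (hf : Growth d f) (hg : Growth d g) : Growth d fun q => f q + g q := by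
  refine ⟨hf.cont.add hg.cont, fun A => ?_⟩
  obtain ⟨C, hC, h1⟩ := hf.bound A
  obtain ⟨D, hD, h2⟩ := hg.bound A
  refine ⟨C + D, by positivity, fun q hq ha hb => ?_⟩
  rw [add_mul]
  exact (abs_add_le _ _).trans (add_le_add (h1 q hq ha hb) (h2 q hq ha hb))

theorem neg (hf : Growth d f) : Growth d fun q => -f q := by
  refine ⟨hf.cont.neg, fun A => ?_⟩
  obtain ⟨C, hC, h1⟩ := hf.bound A
  exact ⟨C, hC, fun q hq ha hb => by rw [abs_neg]; exact h1 q hq ha hb⟩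

theorem sub (hf : Growth d f) (hg : Growth d g) : Growth d fun q => f q - g q := by
  simpa only [sub_eq_add_neg] using hf.add hg.neg

theorem congr (hf : Growth d f) (h : ∀ q : Event, q.2 ≠ 0 → g q = f q) : Growth d g := by
  refine ⟨hf.cont.congr fun q hq => h q hq, fun A => ?_⟩
  obtain ⟨C, hC, h1⟩ := hf.bound A
  exact ⟨C, hC, fun q hq ha hb => by rw [h q hq]; exact h1 q hq ha hb⟩

/-- The bound is only required for ‖y‖ ≤ A, where the surplus power of ‖y‖ is at most a constant. -/
theorem mono (hf : Growth d₁ f) (h : d₂ ≤ d₁) : Growth d₂ f := by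
  refine ⟨hf.cont, fun A => ?_⟩
  obtain ⟨C, hC, h1⟩ := hf.bound A
  refine ⟨C * |A| ^ (d₁ - d₂), by positivity, fun q hq ha hb => (h1 q hq ha hb).trans ?_⟩
  have h0 : 0 < ‖q.2‖ := norm_pos_iff.2 hq
  have : ‖q.2‖ ^ d₁ = ‖q.2‖ ^ (d₁ - d₂) * ‖q.2‖ ^ d₂ := by
    rw [← zpow_add₀ h0.ne', sub_add_cancel]
  rw [this, ← mul_assoc]
  gcongr
  exact zpow_le_zpow_left₀ (by omega) h0.le (hb.trans (le_abs_self A))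

theorem const (c : ℝ) : Growth 0 fun _ => c :=
  ⟨continuousOn_const, fun _ => ⟨|c|, abs_nonneg _, by simp⟩⟩

theorem of_continuous (hf : Continuous f) : Growth 0 f := by
  refine ⟨hf.continuousOn, fun A => ?_⟩
  obtain ⟨C, hC⟩ := ((isCompact_Icc (a := -A) (b := A)).prod
    (isCompact_closedBall (0 : Space) A)).exists_bound_of_continuousOn hf.continuousOn
  refine ⟨|C|, abs_nonneg _, fun q _ ha hb => ?_⟩
  rw [zpow_zero, mul_one]
  exact (hC q ⟨abs_le.1 ha, by simpa using hb⟩).trans (le_abs_self C)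

theorem norm_snd : Growth 1 fun q => ‖q.2‖ :=
  ⟨by fun_prop, fun _ => ⟨1, zero_le_one, by simp⟩⟩

theorem inv_norm_snd : Growth (-1) fun q => ‖q.2‖⁻¹ :=
  ⟨ContinuousOn.inv₀ (by fun_prop) fun q hq => norm_ne_zero_iff.2 hq,
    fun _ => ⟨1, zero_le_one, by simp⟩⟩

/-- A continuous function that is linear in `y`. -/
theorem clm_snd {L : ℝ → Space →L[ℝ] ℝ} (hL : Continuous L) : Growth 1 fun q => L q.1 q.2 := by
  refine ⟨Continuous.continuousOn (by fun_prop), fun A => ?_⟩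
  obtain ⟨C, hC⟩ := (isCompact_Icc (a := -A) (b := A)).exists_bound_of_continuousOn hL.continuousOn
  refine ⟨|C|, abs_nonneg _, fun q _ ha _ => ?_⟩
  rw [zpow_one]
  exact ((L q.1).le_opNorm q.2).trans (by
    gcongr
    exact (hC q.1 (abs_le.1 ha)).trans (le_abs_self C))

/-- The inverse of a function bounded below by a multiple of `‖y‖`. -/
theorem inv_of_le (hf : ContinuousOn f {q | q.2 ≠ 0})
    (h : ∀ A : ℝ, ∃ c : ℝ, 0 < c ∧ ∀ q : Event, |q.1| ≤ A → c * ‖q.2‖ ≤ f q) :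
    Growth (-1) fun q => (f q)⁻¹ := by
  have hpos : ∀ q : Event, q.2 ≠ 0 → 0 < f q := fun q hq => by
    obtain ⟨c, hc, h1⟩ := h |q.1|
    exact (mul_pos hc (norm_pos_iff.2 hq)).trans_le (h1 q le_rfl)
  refine ⟨hf.inv₀ fun q hq => (hpos q hq).ne', fun A => ?_⟩
  obtain ⟨c, hc, h1⟩ := h A
  refine ⟨c⁻¹, by positivity, fun q hq ha _ => ?_⟩
  rw [abs_of_pos (inv_pos.2 (hpos q hq)), zpow_neg_one, ← mul_inv]
  have := norm_pos_iff.2 hq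
  exact inv_anti₀ (by positivity) (h1 q ha)

theorem aestronglyMeasurable (hf : Growth d f) : AEStronglyMeasurable f volume := by
  have hopen : IsOpen {q : Event | q.2 ≠ 0} := isOpen_ne_fun (by fun_prop) (by fun_prop)
  have h := hf.cont.aestronglyMeasurable (μ := volume) hopen.measurableSet
  rwa [Measure.restrict_eq_self_of_ae_mem] at h
  filter_upwards [ae_forall_snd_ne_zero 0] with q hq
  simpa using hq 0

/-- In polar coordinates the factor ρ² of three-space cancels ρ⁻². -/
theorem integrable_indicator_norm_zpow (A : ℝ) :
    Integrable fun y : Space => (Metric.closedBall (0 : Space) A).indicator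
      (fun y => ‖y‖ ^ (-2 : ℤ)) y := by
  have h : Integrable (fun y : Space => (fun ρ : ℝ => (Iic A).indicator
      (fun ρ => ρ ^ (-2 : ℤ)) ρ) ‖y‖) := by
    rw [integrable_fun_norm_addHaar, finrank_space]
    have h1 : IntegrableOn (fun _ : ℝ => (1 : ℝ)) (Ioc 0 A) := by simp
    have h2 : IntegrableOn ((Iic A).indicator fun _ : ℝ => (1 : ℝ)) (Ioi 0) := by
      rw [IntegrableOn, integrable_indicator_iff measurableSet_Iic, IntegrableOn,
        Measure.restrict_restrict measurableSet_Iic, inter_comm, Ioi_inter_Iic]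
      exact h1
    refine h2.congr_fun (fun ρ hρ => ?_) measurableSet_Ioi
    have : ρ ≠ 0 := (mem_Ioi.1 hρ).ne'
    by_cases h : ρ ≤ A
    · simp [indicator, h, this]
    · simp [indicator, h]
  refine h.congr (Eventually.of_forall fun y => ?_)
  simp [indicator]

/-- The majorant is a product of a bounded function of s with ‖y‖⁻² on a ball, so it is integrable.
Exponent -2 is exactly that of the field in cone coordinates. -/
theorem integrable (hf : Growth (-2) f) {A : ℝ}
    (hA : ∀ q, f q ≠ 0 → |q.1| ≤ A ∧ ‖q.2‖ ≤ A) : Integrable f := by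
  obtain ⟨C, hC, h1⟩ := hf.bound A
  have h2 : Integrable (fun s : ℝ => (Icc (-A) A).indicator (fun _ => C) s) :=
    (integrable_indicator_iff measurableSet_Icc).2 (by simp)
  refine (h2.mul_prod (integrable_indicator_norm_zpow A)).mono' hf.aestronglyMeasurable ?_
  filter_upwards [ae_forall_snd_ne_zero 0] with q hq
  replace hq : q.2 ≠ 0 := by simpa using hq 0
  by_cases h : f q = 0
  · rw [h, norm_zero]
    refine mul_nonneg (indicator_nonneg (fun _ _ => hC) _)
      (indicator_nonneg (fun _ _ => by positivity) _)
  · obtain ⟨a, b⟩ := hA q h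
    rw [indicator_of_mem (show q.1 ∈ Icc (-A) A from abs_le.1 a),
      indicator_of_mem (by simpa using b)]
    exact h1 q hq a b

theorem integrable_slice (hf : Growth (-2) f) {s A : ℝ}
    (hA : ∀ y, f (s, y) ≠ 0 → ‖y‖ ≤ A) : Integrable fun y => f (s, y) := by
  obtain ⟨C, hC, h1⟩ := hf.bound (max A |s|)
  have hm : AEStronglyMeasurable (fun y => f (s, y)) volume := by
    have hopen : IsOpen {y : Space | y ≠ 0} := isOpen_ne_fun (by fun_prop) (by fun_prop)
    have h := (hf.cont.comp (f := fun y : Space => ((s, y) : Event)) (s := {y | y ≠ 0})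
      (by fun_prop) fun y hy => hy).aestronglyMeasurable (μ := volume) hopen.measurableSet
    rwa [Measure.restrict_eq_self_of_ae_mem] at h
    filter_upwards [ae_forall_add_smul_ne_zero 0] with q hq
    simpa using hq 0
  refine ((integrable_indicator_norm_zpow (max A |s|)).const_mul C).mono' hm ?_
  filter_upwards [ae_forall_add_smul_ne_zero 0] with q hq
  replace hq : q ≠ 0 := by simpa using hq 0
  by_cases h : f (s, q) = 0
  · rw [h, norm_zero]
    exact mul_nonneg hC (indicator_nonneg (fun _ _ => by positivity) _)
  · have b := (hA q h).trans (le_max_left A |s|)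
    rw [indicator_of_mem (by simpa using b)]
    exact h1 (s, q) hq (le_max_right _ _) b

end Growth

end

/-! ### Jacobian of the light-cone coordinates and change of variables. -/

section ChangeOfVariables

theorem volume_worldLine {r : ℝ → Space} (hr : Continuous r) :
    volume {z : Event | z.2 = r z.1} = 0 := by
  have hm : MeasurableSet {z : Event | z.2 = r z.1} :=
    (isClosed_eq (by fun_prop) (by fun_prop)).measurableSet
  rw [Measure.volume_eq_prod, Measure.measure_prod_null hm]
  refine Eventually.of_forall fun s => ?_
  have : (Prod.mk s ⁻¹' {z : Event | z.2 = r z.1}) = {r s} := by ext; simp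
  simp [this]

/-- In block form the matrix has identity diagonal blocks, so the determinant reduces to the 1 × 1
Schur complement. -/
theorem det_add_smulRight (ℓ : Space →L[ℝ] ℝ) (u : Space) :
    (((ContinuousLinearMap.fst ℝ ℝ Space + ℓ.comp (ContinuousLinearMap.snd ℝ ℝ Space)).prod
      ((ContinuousLinearMap.fst ℝ ℝ Space).smulRight u + ContinuousLinearMap.snd ℝ ℝ Space)) :
      Event →L[ℝ] Event).det = 1 - ℓ u := by
  set L := ((ContinuousLinearMap.fst ℝ ℝ Space + ℓ.comp (ContinuousLinearMap.snd ℝ ℝ Space)).prod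
      ((ContinuousLinearMap.fst ℝ ℝ Space).smulRight u + ContinuousLinearMap.snd ℝ ℝ Space))
  set b := (Module.Basis.singleton Unit ℝ).prod (EuclideanSpace.basisFun (Fin 3) ℝ).toBasis
  have hM : LinearMap.toMatrix b b (L : Event →ₗ[ℝ] Event) =
      Matrix.fromBlocks 1 (Matrix.of fun _ j => ℓ (EuclideanSpace.single j 1))
        (Matrix.of fun i _ => u i) 1 := by
    ext i j
    rcases i with i | i <;> rcases j with j | j <;>
      simp [LinearMap.toMatrix_apply, b, L, Matrix.one_apply]
  rw [ContinuousLinearMap.det, ← LinearMap.det_toMatrix b, hM, Matrix.det_fromBlocks_one₂₂,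
    Matrix.det_unique]
  have hu : u = ∑ j, u j • EuclideanSpace.single j (1 : ℝ) := by
    simpa using ((EuclideanSpace.basisFun (Fin 3) ℝ).sum_repr u).symm
  conv_rhs => rw [hu, map_sum]
  simp [Matrix.mul_apply, mul_comm]

variable {σ : ℝ} {r : ℝ → Space}

theorem hasFDerivAt_norm_snd {q : Event} (hq : q.2 ≠ 0) :
    HasFDerivAt (fun q : Event => ‖q.2‖)
      ((‖q.2‖⁻¹ • innerSL ℝ q.2).comp (ContinuousLinearMap.snd ℝ ℝ Space)) q := by
  have h : HasFDerivAt (fun y : Space => ‖y‖) (‖q.2‖⁻¹ • innerSL ℝ q.2) q.2 := by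
    have h1 := (hasStrictFDerivAt_norm_sq q.2).hasFDerivAt.sqrt
      (by positivity)
    simp only [Real.sqrt_sq (norm_nonneg _)] at h1
    refine h1.congr_fderiv ?_
    ext v
    simp
    field_simp
  exact h.comp q hasFDerivAt_snd

/-- The derivative of the light-cone coordinates. -/
def coneDeriv (σ : ℝ) (r : ℝ → Space) (q : Event) : Event →L[ℝ] Event :=
  (ContinuousLinearMap.fst ℝ ℝ Space +
    ((σ * ‖q.2‖⁻¹) • innerSL ℝ q.2).comp (ContinuousLinearMap.snd ℝ ℝ Space)).prod
  ((ContinuousLinearMap.fst ℝ ℝ Space).smulRight (deriv r q.1) + ContinuousLinearMap.snd ℝ ℝ Space)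

theorem coneDeriv_apply (q w : Event) : coneDeriv σ r q w =
    (w.1 + σ * ‖q.2‖⁻¹ * inner ℝ q.2 w.2, w.1 • deriv r q.1 + w.2) := by
  simp [coneDeriv]

theorem hasFDerivAt_coneMap (hr : ContDiff ℝ 2 r) {q : Event} (hq : q.2 ≠ 0) :
    HasFDerivAt (coneMap σ r) (coneDeriv σ r q) q := by
  have h1 : HasFDerivAt (fun q : Event => r q.1)
      ((ContinuousLinearMap.fst ℝ ℝ Space).smulRight (deriv r q.1)) q := by
    have := ((hr.differentiable (by norm_num)).differentiableAt
      (x := q.1)).hasDerivAt.hasFDerivAt.comp q (hasFDerivAt_fst (p := q) (𝕜 := ℝ))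
    refine this.congr_fderiv ?_
    ext <;> simp
  have := (hasFDerivAt_fst.add ((hasFDerivAt_norm_snd hq).const_mul σ)).prodMk
    (h1.add hasFDerivAt_snd)
  refine this.congr_fderiv ?_
  ext <;> simp [coneDeriv, mul_assoc]

theorem det_coneDeriv (q : Event) :
    (coneDeriv σ r q).det = 1 - σ * ‖q.2‖⁻¹ * inner ℝ q.2 (deriv r q.1) := by
  rw [coneDeriv, det_add_smulRight]
  simp

theorem abs_det_coneDeriv (hsub : ∀ t, ‖deriv r t‖ < 1) (hσ : σ = 1 ∨ σ = -1) {q : Event}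
    (hq : q.2 ≠ 0) : |(coneDeriv σ r q).det| =
      ‖q.2‖⁻¹ * (‖q.2‖ - σ * inner ℝ q.2 (deriv r q.1)) := by
  have h0 := norm_pos_iff.2 hq
  have h1 := abs_real_inner_le_norm q.2 (deriv r q.1)
  have h2 : ‖q.2‖ * ‖deriv r q.1‖ ≤ ‖q.2‖ := by nlinarith [hsub q.1]
  have h3 := abs_le.1 (h1.trans h2)
  rw [det_coneDeriv]
  have h4 : 1 - σ * ‖q.2‖⁻¹ * inner ℝ q.2 (deriv r q.1) =
      ‖q.2‖⁻¹ * (‖q.2‖ - σ * inner ℝ q.2 (deriv r q.1)) := by field_simp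
  rw [h4, abs_of_nonneg]
  refine mul_nonneg (by positivity) ?_
  rcases hσ with rfl | rfl <;> linarith

/-- Change of variables to light-cone coordinates. -/
theorem integral_comp_coneMap (hr : ContDiff ℝ 2 r) (hsub : ∀ t, ‖deriv r t‖ < 1)
    (hσ : σ = 1 ∨ σ = -1) {G H : Event → ℝ}
    (hG : ∀ z, z ∉ range (coneMap σ r) → G z = 0)
    (hH : ∀ q : Event, q.2 ≠ 0 → H q =
      ‖q.2‖⁻¹ * (‖q.2‖ - σ * inner ℝ q.2 (deriv r q.1)) * G (coneMap σ r q)) :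
    (Integrable G ↔ Integrable H) ∧ ∫ z, G z = ∫ q, H q := by
  set S : Set Event := {q | q.2 ≠ 0}
  have hS : MeasurableSet S :=
    IsOpen.measurableSet (isOpen_ne_fun (by fun_prop) (by fun_prop))
  have hd : ∀ q ∈ S, HasFDerivWithinAt (coneMap σ r) (coneDeriv σ r q) S q :=
    fun q hq => (hasFDerivAt_coneMap hr hq).hasFDerivWithinAt
  have hinj := (coneMap_injective hr hsub hσ).injOn (s := S)
  have hSae : ∀ᵐ q : Event, q ∈ S := by
    filter_upwards [ae_forall_snd_ne_zero 0] with q hq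
    simpa [S] using hq 0
  have him : MeasurableSet (coneMap σ r '' S) :=
    hS.image_of_continuousOn_injOn (continuous_coneMap hr).continuousOn hinj
  -- Removing the axis y = 0 from the coordinates removes only world-line events from the image, a
  -- null set; outside the range `G` vanishes.
  have hae : (coneMap σ r '' S).indicator G =ᵐ[volume] G := by
    have := volume_worldLine hr.continuous
    rw [measure_eq_zero_iff_ae_notMem] at this
    filter_upwards [this] with z hz
    by_cases h : z ∈ range (coneMap σ r)
    · obtain ⟨q, rfl⟩ := h
      refine indicator_of_mem (mem_image_of_mem _ (show q.2 ≠ 0 from fun h0 => hz ?_)) _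
      simp [coneMap, h0]
    · rw [hG z h]
      exact indicator_apply_eq_zero.2 fun _ => hG z h
  have hHS : ∀ q ∈ S, H q = |(coneDeriv σ r q).det| • G (coneMap σ r q) := fun q hq => by
    rw [abs_det_coneDeriv hsub hσ hq, hH q hq, smul_eq_mul]
  constructor
  · rw [← integrable_congr hae, integrable_indicator_iff him,
      integrableOn_image_iff_integrableOn_abs_det_fderiv_smul volume hS hd hinj,
      ← integrableOn_congr_fun hHS hS, IntegrableOn, Measure.restrict_eq_self_of_ae_mem hSae]
  · rw [← integral_congr_ae hae, integral_indicator him,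
      integral_image_eq_integral_abs_det_fderiv_smul volume hS hd hinj,
      ← setIntegral_congr_fun hS hHS, Measure.restrict_eq_self_of_ae_mem hSae]

end ChangeOfVariables

/-! ### Growth classes with a directional derivative; calculus along the trajectory. -/

section

/-- `f` has growth of degree `d` at the axis and its derivative `f'` in the direction `w` has
growth of degree `d - 1`. -/
structure GrowthDeriv (d : ℤ) (w : Event) (f f' : Event → ℝ) : Prop where
  growth : Growth d f
  growth' : Growth (d - 1) f'
  deriv : ∀ q : Event, q.2 ≠ 0 → HasLineDerivAt ℝ f (f' q) q w

namespace GrowthDeriv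

variable {d d₁ d₂ : ℤ} {w : Event} {f f' g g' : Event → ℝ}

theorem mul (hf : GrowthDeriv d₁ w f f') (hg : GrowthDeriv d₂ w g g') :
    GrowthDeriv (d₁ + d₂) w (fun q => f q * g q) (fun q => f' q * g q + f q * g' q) := by
  refine ⟨hf.growth.mul hg.growth, ?_, fun q hq => ?_⟩
  · refine Growth.add ?_ ?_
    · convert hf.growth'.mul hg.growth using 1; ring
    · convert hf.growth.mul hg.growth' using 1; ring
  · have := HasDerivAt.mul (hf.deriv q hq) (hg.deriv q hq)
    simp only [zero_smul, add_zero] at this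
    exact this

theorem add (hf : GrowthDeriv d w f f') (hg : GrowthDeriv d w g g') :
    GrowthDeriv d w (fun q => f q + g q) (fun q => f' q + g' q) :=
  ⟨hf.growth.add hg.growth, hf.growth'.add hg.growth',
    fun q hq => HasDerivAt.add (hf.deriv q hq) (hg.deriv q hq)⟩

theorem sub (hf : GrowthDeriv d w f f') (hg : GrowthDeriv d w g g') :
    GrowthDeriv d w (fun q => f q - g q) (fun q => f' q - g' q) :=
  ⟨hf.growth.sub hg.growth, hf.growth'.sub hg.growth',
    fun q hq => HasDerivAt.sub (hf.deriv q hq) (hg.deriv q hq)⟩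

theorem const_mul (hf : GrowthDeriv d w f f') (c : ℝ) :
    GrowthDeriv d w (fun q => c * f q) (fun q => c * f' q) := by
  refine ⟨?_, ?_, fun q hq => HasDerivAt.const_mul c (hf.deriv q hq)⟩
  · simpa using (Growth.const c).mul hf.growth
  · simpa using (Growth.const c).mul hf.growth'

theorem mono (hf : GrowthDeriv d₁ w f f') (h : d₂ ≤ d₁) : GrowthDeriv d₂ w f f' :=
  ⟨hf.growth.mono h, hf.growth'.mono (by omega), hf.deriv⟩

theorem congr' (hf : GrowthDeriv d w f f') (h : ∀ q : Event, q.2 ≠ 0 → g' q = f' q) :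
    GrowthDeriv d w f g' :=
  ⟨hf.growth, hf.growth'.congr h, fun q hq => by rw [h q hq]; exact hf.deriv q hq⟩

theorem inv (hf : GrowthDeriv 1 w f f') (hi : Growth (-1) fun q => (f q)⁻¹)
    (h0 : ∀ q : Event, q.2 ≠ 0 → f q ≠ 0) :
    GrowthDeriv (-1) w (fun q => (f q)⁻¹) (fun q => -f' q * (f q)⁻¹ * (f q)⁻¹) := by
  refine ⟨hi, (hf.growth'.neg.mul hi).mul hi, fun q hq => ?_⟩
  have := HasDerivAt.inv (hf.deriv q hq) (by simpa using h0 q hq)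
  have e : -f' q * (f q)⁻¹ * (f q)⁻¹ = -f' q / f (q + (0 : ℝ) • w) ^ 2 := by
    rw [zero_smul, add_zero, div_eq_mul_inv, pow_two, mul_inv, mul_assoc]
  rw [e]
  exact this

theorem of_hasFDerivAt {f'' : Event → Event →L[ℝ] ℝ} (hg : Growth d f)
    (hg' : Growth (d - 1) fun q => f'' q w)
    (h : ∀ q : Event, q.2 ≠ 0 → HasFDerivAt f (f'' q) q) :
    GrowthDeriv d w f fun q => f'' q w :=
  ⟨hg, hg', fun q hq => (h q hq).hasLineDerivAt w⟩

theorem const (c : ℝ) : GrowthDeriv 0 w (fun _ => c) (fun _ => 0) :=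
  of_hasFDerivAt (f'' := fun _ => 0) (Growth.const c)
    ((Growth.const 0).mono (by norm_num)) (fun _ _ => hasFDerivAt_const c _)

theorem clm_snd (P : Space →L[ℝ] ℝ) : GrowthDeriv 1 w (fun q => P q.2) (fun _ => P w.2) :=
  of_hasFDerivAt (f'' := fun _ => P.comp (ContinuousLinearMap.snd ℝ ℝ Space))
    (Growth.clm_snd (L := fun _ => P) continuous_const) (Growth.const _)
    (fun _ _ => P.hasFDerivAt.comp _ hasFDerivAt_snd)

theorem norm_snd : GrowthDeriv 1 w (fun q => ‖q.2‖) (fun q => ‖q.2‖⁻¹ * inner ℝ q.2 w.2) := by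
  refine of_hasFDerivAt
    (f'' := fun q => (‖q.2‖⁻¹ • innerSL ℝ q.2).comp (ContinuousLinearMap.snd ℝ ℝ Space))
    Growth.norm_snd ?_ (fun q hq => hasFDerivAt_norm_snd hq)
  have := Growth.inv_norm_snd.mul
    (Growth.clm_snd (L := fun _ => innerSL ℝ w.2) continuous_const)
  refine this.congr fun q _ => ?_
  simp [real_inner_comm]

theorem inv_norm_snd : GrowthDeriv (-1) w (fun q => ‖q.2‖⁻¹)
    (fun q => -(‖q.2‖⁻¹ * inner ℝ q.2 w.2) * ‖q.2‖⁻¹ * ‖q.2‖⁻¹) :=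
  norm_snd.inv Growth.inv_norm_snd fun _ hq => norm_ne_zero_iff.2 hq

/-- The integral of the derivative vanishes. -/
theorem integral_eq_zero (hf : GrowthDeriv (-1) w f f') {A : ℝ}
    (hA : ∀ q, f q ≠ 0 → |q.1| ≤ A ∧ ‖q.2‖ ≤ A) (hA' : ∀ q, f' q ≠ 0 → |q.1| ≤ A ∧ ‖q.2‖ ≤ A) :
    ∫ q, f' q = 0 := by
  -- The function has exponent -1 and its derivative -2, so both are integrable. Almost every line
  -- in direction `w` avoids the axis and is therefore regular throughout.
  refine integral_eq_zero_of_hasDerivAt_line volume (v := w)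
    ((hf.growth.mono (by norm_num)).integrable hA) (hf.growth'.integrable hA') ?_
  filter_upwards [ae_forall_snd_ne_zero w] with q hq t
  have := HasDerivAt.comp_sub_const t t (by rw [sub_self]; exact hf.deriv _ (hq t))
  refine this.congr_of_eventuallyEq (Eventually.of_forall fun t' => ?_)
  simp only [add_assoc, ← add_smul]
  simp

theorem integrable_and_integral_eq_zero (hf : GrowthDeriv (-1) w f f') {A : ℝ}
    (hA : ∀ q : Event, ¬(|q.1| ≤ A ∧ ‖q.2‖ ≤ A) → f q = 0 ∧ f' q = 0) :
    Integrable f' ∧ ∫ q, f' q = 0 := by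
  have h' : ∀ q, f' q ≠ 0 → |q.1| ≤ A ∧ ‖q.2‖ ≤ A := fun q hq =>
    by_contra fun h => hq (hA q h).2
  exact ⟨hf.growth'.integrable h',
    hf.integral_eq_zero (fun q hq => by_contra fun h => hq (hA q h).1) h'⟩

theorem integrable_slice_and_integral_eq_zero {v : Space} (hf : GrowthDeriv (-1) (0, v) f f')
    {s A : ℝ} (hA : ∀ y, ¬‖y‖ ≤ A → f (s, y) = 0 ∧ f' (s, y) = 0) :
    Integrable (fun y => f' (s, y)) ∧ ∫ y, f' (s, y) = 0 := by
  have h1 : Integrable fun y => f' (s, y) :=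
    hf.growth'.integrable_slice (A := A) fun y hy => by_contra fun h => hy (hA y h).2
  have h0 : Integrable fun y => f (s, y) := (hf.growth.mono (by norm_num)).integrable_slice
    (A := A) fun y hy => by_contra fun h => hy (hA y h).1
  refine ⟨h1, integral_eq_zero_of_hasDerivAt_line volume (v := v) h0 h1 ?_⟩
  filter_upwards [ae_forall_add_smul_ne_zero v] with q hq t
  have := HasDerivAt.comp_sub_const t t
    (by rw [sub_self]; exact hf.deriv (s, q + t • v) (hq t))
  refine this.congr_of_eventuallyEq (Eventually.of_forall fun t' => ?_)
  simp only [Prod.smul_mk, Prod.mk_add_mk, smul_zero, add_zero, add_assoc, ← add_smul]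
  simp

section Trajectory

variable {σ : ℝ} {r : ℝ → Space}

theorem continuous_deriv_deriv (hr : ContDiff ℝ 2 r) : Continuous (_root_.deriv (_root_.deriv r)) :=
  (hr.iterate_deriv' 0 2).continuous

theorem hasFDerivAt_velocity (hr : ContDiff ℝ 2 r) (q : Event) :
    HasFDerivAt (fun q : Event => _root_.deriv r q.1)
      ((ContinuousLinearMap.fst ℝ ℝ Space).smulRight (_root_.deriv (_root_.deriv r) q.1)) q := by
  have hd : Differentiable ℝ (_root_.deriv r) :=
    (hr.iterate_deriv' 1 1).differentiable (by norm_num)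
  have := (hd.differentiableAt (x := q.1)).hasDerivAt.hasFDerivAt.comp q
    (hasFDerivAt_fst (p := q) (𝕜 := ℝ))
  refine this.congr_fderiv ?_
  ext <;> simp

theorem velocity (hr : ContDiff ℝ 2 r) (P : Space →L[ℝ] ℝ) :
    GrowthDeriv 0 w (fun q => P (_root_.deriv r q.1))
      (fun q => w.1 * P (_root_.deriv (_root_.deriv r) q.1)) := by
  have h1 := hr.continuous_deriv (by norm_num)
  have h2 := continuous_deriv_deriv hr
  have := of_hasFDerivAt (w := w) (d := 0) (f := fun q => P (_root_.deriv r q.1))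
    (f'' := fun q => P.comp ((ContinuousLinearMap.fst ℝ ℝ Space).smulRight
      (_root_.deriv (_root_.deriv r) q.1)))
    (Growth.of_continuous (by fun_prop))
    ((Growth.of_continuous (by simp; fun_prop)).mono (by norm_num))
    (fun q _ => P.hasFDerivAt.comp q (hasFDerivAt_velocity hr q))
  simpa using this

theorem bilin_velocity (hr : ContDiff ℝ 2 r) (Q : Space →L[ℝ] Space →L[ℝ] ℝ) :
    GrowthDeriv 1 w (fun q => Q q.2 (_root_.deriv r q.1))
      (fun q => Q w.2 (_root_.deriv r q.1) +
        w.1 * Q q.2 (_root_.deriv (_root_.deriv r) q.1)) := by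
  have h1 := hr.continuous_deriv (by norm_num)
  have h2 := continuous_deriv_deriv hr
  have e := of_hasFDerivAt (w := w) (d := 1) (f := fun q => Q q.2 (_root_.deriv r q.1))
    (f'' := fun q => Q.precompR Event q.2 ((ContinuousLinearMap.fst ℝ ℝ Space).smulRight
      (_root_.deriv (_root_.deriv r) q.1)) + Q.precompL Event (ContinuousLinearMap.snd ℝ ℝ Space)
      (_root_.deriv r q.1))
    (Growth.clm_snd (L := fun s => Q.flip (_root_.deriv r s)) (by fun_prop))
    ((Growth.of_continuous (by simp; fun_prop)).mono (by norm_num))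
    (fun q _ => Q.hasFDerivAt_of_bilinear hasFDerivAt_snd (hasFDerivAt_velocity hr q))
  refine e.congr' fun q _ => ?_
  simp [add_comm]

/-- On a bounded time interval the speed has a maximum below 1, and `c` is one minus that maximum.
This bounds the denominators of the field by powers of ‖y‖ alone, without any global bound on the
speed. -/
theorem le_retarded_norm (hr : ContDiff ℝ 2 r) (hsub : ∀ t, ‖_root_.deriv r t‖ < 1)
    (hσ : σ = 1 ∨ σ = -1) (A : ℝ) :
    ∃ c : ℝ, 0 < c ∧ ∀ q : Event, |q.1| ≤ A →
      c * ‖q.2‖ ≤ ‖q.2‖ - σ * inner ℝ q.2 (_root_.deriv r q.1) := by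
  have h1 := hr.continuous_deriv (by norm_num)
  obtain ⟨x, -, hx⟩ := (isCompact_Icc (a := -|A|) (b := |A|)).exists_isMaxOn
    (nonempty_Icc.2 (by linarith [abs_nonneg A])) h1.norm.continuousOn
  refine ⟨1 - ‖_root_.deriv r x‖, by linarith [hsub x], fun q hq => ?_⟩
  have h2 : ‖_root_.deriv r q.1‖ ≤ ‖_root_.deriv r x‖ := hx (abs_le.1 (hq.trans (le_abs_self A)))
  have h3 := abs_real_inner_le_norm q.2 (_root_.deriv r q.1)
  have h4 := abs_le.1 (h3.trans (mul_le_mul_of_nonneg_left h2 (norm_nonneg q.2)))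
  rcases hσ with rfl | rfl <;> nlinarith

theorem retarded_norm_pos (hr : ContDiff ℝ 2 r) (hsub : ∀ t, ‖_root_.deriv r t‖ < 1)
    (hσ : σ = 1 ∨ σ = -1) {q : Event} (hq : q.2 ≠ 0) :
    0 < ‖q.2‖ - σ * inner ℝ q.2 (_root_.deriv r q.1) := by
  obtain ⟨c, hc, h⟩ := le_retarded_norm hr hsub hσ |q.1|
  exact (mul_pos hc (norm_pos_iff.2 hq)).trans_le (h q le_rfl)

theorem retarded_norm (hr : ContDiff ℝ 2 r) (σ : ℝ) :
    GrowthDeriv 1 w (fun q => ‖q.2‖ - σ * inner ℝ q.2 (_root_.deriv r q.1))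
      (fun q => ‖q.2‖⁻¹ * inner ℝ q.2 w.2 - σ * (inner ℝ w.2 (_root_.deriv r q.1) +
        w.1 * inner ℝ q.2 (_root_.deriv (_root_.deriv r) q.1))) :=
  norm_snd.sub ((bilin_velocity hr (innerSL ℝ)).const_mul σ)

theorem inv_retarded_norm (hr : ContDiff ℝ 2 r) (hsub : ∀ t, ‖_root_.deriv r t‖ < 1)
    (hσ : σ = 1 ∨ σ = -1) :
    GrowthDeriv (-1) w (fun q => (‖q.2‖ - σ * inner ℝ q.2 (_root_.deriv r q.1))⁻¹)
      (fun q => -(‖q.2‖⁻¹ * inner ℝ q.2 w.2 - σ * (inner ℝ w.2 (_root_.deriv r q.1) +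
        w.1 * inner ℝ q.2 (_root_.deriv (_root_.deriv r) q.1))) *
        (‖q.2‖ - σ * inner ℝ q.2 (_root_.deriv r q.1))⁻¹ *
        (‖q.2‖ - σ * inner ℝ q.2 (_root_.deriv r q.1))⁻¹) :=
  (retarded_norm hr σ).inv
    (Growth.inv_of_le (retarded_norm (w := w) hr σ).growth.cont (le_retarded_norm hr hsub hσ))
    fun _ hq => (retarded_norm_pos hr hsub hσ hq).ne'

theorem comp_coneMap (hr : ContDiff ℝ 2 r) {χ : Event → ℝ} (hχ : ContDiff ℝ 1 χ) :
    GrowthDeriv 0 w (fun q => χ (coneMap σ r q))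
      (fun q => fderiv ℝ χ (coneMap σ r q) (coneDeriv σ r q w)) := by
  have hc := continuous_coneMap (σ := σ) hr
  have hf := hχ.continuous_fderiv (by norm_num)
  have h1 := hr.continuous_deriv (by norm_num)
  refine of_hasFDerivAt (f'' := fun q => (fderiv ℝ χ (coneMap σ r q)).comp (coneDeriv σ r q))
    (Growth.of_continuous (hχ.continuous.comp hc)) ?_
    (fun q hq => ((hχ.differentiable (by norm_num)).differentiableAt.hasFDerivAt).comp q
      (hasFDerivAt_coneMap hr hq))
  -- The derivative of the cone coordinates is continuous except for the term with y/‖y‖, which is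
  -- bounded. It is split off here.
  have e : Growth 0 fun q => fderiv ℝ χ (coneMap σ r q) (w.1, w.1 • _root_.deriv r q.1 + w.2) +
      fderiv ℝ χ (coneMap σ r q) (1, 0) * (σ * (‖q.2‖⁻¹ * inner ℝ w.2 q.2)) := by
    refine Growth.add (Growth.of_continuous (by fun_prop)) ?_
    have a := (Growth.of_continuous (f := fun q => fderiv ℝ χ (coneMap σ r q) (1, 0))
      (by fun_prop)).mul ((Growth.const σ).mul (Growth.inv_norm_snd.mul
        (Growth.clm_snd (L := fun _ => innerSL ℝ w.2) continuous_const)))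
    exact a.congr fun q _ => by simp
  refine (e.mono (by norm_num)).congr fun q _ => ?_
  rw [ContinuousLinearMap.comp_apply, coneDeriv_apply]
  have : ((w.1 + σ * ‖q.2‖⁻¹ * inner ℝ q.2 w.2, w.1 • _root_.deriv r q.1 + w.2) : Event) =
      (w.1, w.1 • _root_.deriv r q.1 + w.2) +
        (σ * (‖q.2‖⁻¹ * inner ℝ w.2 q.2)) • ((1, 0) : Event) := by
    simp [real_inner_comm, mul_assoc]
  rw [this, map_add, map_smul, smul_eq_mul, mul_comm (σ * _)]

end Trajectory
end GrowthDeriv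

end

/-! ### The explicit field as a divergence identity in cone coordinates. -/

section

/-- A real component of the retarded (`σ = 1`) or advanced (`σ = -1`) field; `P` and `Q` are the
components of `v ↦ v ∧ b⁰` and `(v, w) ↦ v ∧ w`. -/
def fieldComp (σ : ℝ) (P : Space →L[ℝ] ℝ) (Q : Space →L[ℝ] Space →L[ℝ] ℝ) (R u a : Space) : ℝ :=
  ((‖R‖ - σ * inner ℝ R u) ^ 3)⁻¹ * (1 - ‖u‖ ^ 2 + inner ℝ R a) *
      (P R - σ * (‖R‖ * P u) - Q R u)
    - ((‖R‖ - σ * inner ℝ R u) ^ 2)⁻¹ * (‖R‖ * P a + σ * Q R a)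

/-- The derivative contracted with the current: `∂_t φ P(u) + ∂_i φ (P(e_i) - Q(e_i, u))`. -/
def contractedDeriv (P : Space →L[ℝ] ℝ) (Q : Space →L[ℝ] Space →L[ℝ] ℝ) (φ : Event → ℝ)
    (z : Event) (u : Space) : ℝ :=
  fderiv ℝ φ z (1, 0) * P u + ∑ i : Fin 3, fderiv ℝ φ z (0, EuclideanSpace.single i 1) *
    (P (EuclideanSpace.single i 1) - Q (EuclideanSpace.single i 1) u)

theorem sum_apply_single (L : Space →L[ℝ] ℝ) (u : Space) :
    ∑ i : Fin 3, u i * L (EuclideanSpace.single i 1) = L u := by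
  have hu : u = ∑ j, u j • EuclideanSpace.single j (1 : ℝ) := by
    simpa using ((EuclideanSpace.basisFun (Fin 3) ℝ).sum_repr u).symm
  conv_rhs => rw [hu, map_sum]
  simp

theorem sum_mul_eq_inner (y u : Space) : ∑ i : Fin 3, u i * y i = inner ℝ y u := by
  simp [PiLp.inner_apply]

theorem fderiv_prod_apply (φ : Event → ℝ) (z : Event) (t : ℝ) (v : Space) :
    fderiv ℝ φ z (t, v) = t * fderiv ℝ φ z (1, 0) + fderiv ℝ φ z (0, v) := by
  have : ((t, v) : Event) = t • ((1, 0) : Event) + (0, v) := by simp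
  rw [this, map_add, map_smul, smul_eq_mul]

/-- Here ρ = |y|, w = y·u, N = P(y) - Q(y, u) and ψ is the test function in cone coordinates. Put T
= ψ(σN - ρP(u))/(ρk) and c_i = P(e_i) - Q(e_i, u). The left side is -∂_s T + ∂_i(u_i T + c_i ψ/ρ)
with the product rule carried out. The coefficient T arises by replacing each ∂_t φ by (ρ/k)(∂_s -
u·∂_y)ψ. -/
theorem field_algebra {σ ρ k w N Pu Pa Qya ya uu Dt Du Z ψ : ℝ} (hσ : σ = 1 ∨ σ = -1)
    (hρ : ρ ≠ 0) (hk : k ≠ 0) (hkw : k = ρ - σ * w) :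
    -((Dt + Du) * ((σ * N - ρ * Pu) * (ρ⁻¹ * k⁻¹)) + ψ * ((-(σ * Qya) - ρ * Pa) * (ρ⁻¹ * k⁻¹) +
        (σ * N - ρ * Pu) * (ρ⁻¹ * (σ * ya * k⁻¹ * k⁻¹)))) +
    ((σ * ρ⁻¹ * w * Dt + Du) * ((σ * N - ρ * Pu) * (ρ⁻¹ * k⁻¹)) +
      ψ * ((σ * Pu - ρ⁻¹ * w * Pu) * (ρ⁻¹ * k⁻¹) + (σ * N - ρ * Pu) *
        (-(ρ⁻¹ * w) * ρ⁻¹ * ρ⁻¹ * k⁻¹ + ρ⁻¹ * (-(ρ⁻¹ * w - σ * uu) * k⁻¹ * k⁻¹)))) +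
    (-(ρ⁻¹ * N) * ρ⁻¹ * ρ⁻¹ * ψ + ρ⁻¹ * (σ * ρ⁻¹ * N * Dt + Z)) =
    ρ⁻¹ * (Dt * Pu + Z) - ρ⁻¹ * k * (ψ * ((k ^ 3)⁻¹ * (1 - uu + ya) * (N - σ * (ρ * Pu)) -
      (k ^ 2)⁻¹ * (ρ * Pa + σ * Qya))) := by
  have hw : w = σ * (ρ - k) := by rcases hσ with rfl | rfl <;> linarith
  subst hw
  clear hkw
  rcases hσ with rfl | rfl <;> field_simp <;> ring

variable {σ : ℝ} {r : ℝ → Space}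

theorem growth_fieldComp (hr : ContDiff ℝ 2 r) (hsub : ∀ t, ‖deriv r t‖ < 1)
    (hσ : σ = 1 ∨ σ = -1) (P : Space →L[ℝ] ℝ) (Q : Space →L[ℝ] Space →L[ℝ] ℝ) :
    Growth (-2) fun q => fieldComp σ P Q q.2 (deriv r q.1) (deriv (deriv r) q.1) := by
  have h1 := hr.continuous_deriv (by norm_num)
  have h2 := GrowthDeriv.continuous_deriv_deriv hr
  have hk := (GrowthDeriv.inv_retarded_norm (w := 0) hr hsub hσ).growth
  have g1 : Growth 0 fun q => 1 - ‖deriv r q.1‖ ^ 2 + inner ℝ q.2 (deriv (deriv r) q.1) :=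
    Growth.of_continuous (by fun_prop)
  have g2 : Growth 1 fun q => P q.2 - σ * (‖q.2‖ * P (deriv r q.1)) - Q q.2 (deriv r q.1) :=
    ((GrowthDeriv.clm_snd (w := 0) P).growth.sub ((Growth.const σ).mul
      (Growth.norm_snd.mul (GrowthDeriv.velocity (w := 0) hr P).growth))).sub
      (GrowthDeriv.bilin_velocity (w := 0) hr Q).growth
  have g3 : Growth 1 fun q => ‖q.2‖ * P (deriv (deriv r) q.1) +
      σ * Q q.2 (deriv (deriv r) q.1) :=
    (Growth.norm_snd.mul (Growth.of_continuous (by fun_prop))).add ((Growth.const σ).mul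
      (Growth.clm_snd (L := fun s => Q.flip (deriv (deriv r) s)) (by fun_prop)))
  have a1 : Growth (-2) _ := ((hk.mul (hk.mul hk)).mul g1).mul g2
  have a2 : Growth (-1) _ := (hk.mul hk).mul g3
  refine (a1.sub (a2.mono (by norm_num))).congr fun q _ => ?_
  simp only [fieldComp, pow_succ, pow_zero, one_mul, mul_inv]
  ring

theorem growth_contractedDeriv (hr : ContDiff ℝ 2 r) (P : Space →L[ℝ] ℝ)
    (Q : Space →L[ℝ] Space →L[ℝ] ℝ) {φ : Event → ℝ} (hφ : ContDiff ℝ 1 φ) :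
    Growth 0 fun q => contractedDeriv P Q φ (coneMap σ r q) (deriv r q.1) := by
  have h1 := hr.continuous_deriv (by norm_num)
  have hc := continuous_coneMap (σ := σ) hr
  have hf := hφ.continuous_fderiv (by norm_num)
  unfold contractedDeriv
  exact Growth.of_continuous (by fun_prop)

theorem fderiv_eq_zero_of_notMem_tsupport {φ : Event → ℝ} {z : Event} (h : z ∉ tsupport φ) :
    fderiv ℝ φ z = 0 :=
  Function.notMem_support.1 fun h' => h (support_fderiv_subset ℝ h')

theorem integral_divergence {F g : Event → ℝ} {G : Fin 3 → Event → ℝ}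
    (hg : Integrable g ∧ ∫ q, g q = 0) (hG : ∀ i, Integrable (G i) ∧ ∫ q, G i q = 0)
    (h : ∀ q : Event, q.2 ≠ 0 → F q = -g q + ∑ i, G i q) : ∫ q, F q = 0 := by
  have hae : F =ᵐ[volume] fun q => -g q + ∑ i, G i q := by
    filter_upwards [ae_forall_snd_ne_zero 0] with q hq
    exact h q (by simpa using hq 0)
  rw [integral_congr_ae hae, integral_add (f := fun q => -g q) hg.1.neg (integrable_finsetSum _ fun i _ => (hG i).1),
    integral_neg, integral_finsetSum _ fun i _ => (hG i).1, hg.2]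
  simp [(hG _).2]

/-- The Jacobian has exponent 0 and the field -2, the borderline that `Growth.integrable` admits. -/
theorem integrable_field_coneMap (hr : ContDiff ℝ 2 r) (hsub : ∀ t, ‖deriv r t‖ < 1)
    (hσ : σ = 1 ∨ σ = -1) (P : Space →L[ℝ] ℝ) (Q : Space →L[ℝ] Space →L[ℝ] ℝ)
    {φ : Event → ℝ} (hφ : Continuous φ) {A : ℝ}
    (hA : ∀ q, coneMap σ r q ∈ tsupport φ → |q.1| ≤ A ∧ ‖q.2‖ ≤ A) :
    Integrable (fun q : Event => ‖q.2‖⁻¹ * (‖q.2‖ - σ * inner ℝ q.2 (deriv r q.1)) *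
      (φ (coneMap σ r q) * fieldComp σ P Q q.2 (deriv r q.1) (deriv (deriv r) q.1))) := by
  refine Growth.integrable (A := A) ((Growth.inv_norm_snd.mul
    (GrowthDeriv.retarded_norm (w := 0) hr σ).growth).mul
    ((Growth.of_continuous (hφ.comp (continuous_coneMap hr))).mul
      (growth_fieldComp hr hsub hσ P Q))) fun q hq => hA q ?_
  by_contra h
  simp [image_eq_zero_of_notMem_tsupport h] at hq

/-- The field identity in light-cone coordinates. -/
theorem integral_field_coneMap (hr : ContDiff ℝ 2 r) (hsub : ∀ t, ‖deriv r t‖ < 1)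
    (hσ : σ = 1 ∨ σ = -1) (P : Space →L[ℝ] ℝ) (Q : Space →L[ℝ] Space →L[ℝ] ℝ)
    (hQ : ∀ v, Q v v = 0) {φ : Event → ℝ} (hφ : ContDiff ℝ 1 φ) {A : ℝ}
    (hA : ∀ q, coneMap σ r q ∈ tsupport φ → |q.1| ≤ A ∧ ‖q.2‖ ≤ A) :
    Integrable (fun q : Event =>
      ‖q.2‖⁻¹ * contractedDeriv P Q φ (coneMap σ r q) (deriv r q.1)) ∧
    Integrable (fun q : Event => ‖q.2‖⁻¹ * (‖q.2‖ - σ * inner ℝ q.2 (deriv r q.1)) *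
      (φ (coneMap σ r q) * fieldComp σ P Q q.2 (deriv r q.1) (deriv (deriv r) q.1))) ∧
    ∫ q : Event, ‖q.2‖⁻¹ * contractedDeriv P Q φ (coneMap σ r q) (deriv r q.1) =
    ∫ q : Event, ‖q.2‖⁻¹ * (‖q.2‖ - σ * inner ℝ q.2 (deriv r q.1)) *
      (φ (coneMap σ r q) * fieldComp σ P Q q.2 (deriv r q.1) (deriv (deriv r) q.1)) := by
  have hz : ∀ q, ¬(|q.1| ≤ A ∧ ‖q.2‖ ≤ A) →
      φ (coneMap σ r q) = 0 ∧ fderiv ℝ φ (coneMap σ r q) = 0 := fun q hq => by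
    have h := fun h => hq (hA q h)
    exact ⟨image_eq_zero_of_notMem_tsupport h, fderiv_eq_zero_of_notMem_tsupport h⟩
  have i1 : Integrable (fun q : Event =>
      ‖q.2‖⁻¹ * contractedDeriv P Q φ (coneMap σ r q) (deriv r q.1)) := by
    refine Growth.integrable (A := A) ((Growth.inv_norm_snd.mul
      (growth_contractedDeriv hr P Q hφ)).mono (by norm_num)) fun q hq => ?_
    by_contra h
    simp [contractedDeriv, hz q h] at hq
  have i2 := integrable_field_coneMap hr hsub hσ P Q hφ.continuous hA
  refine ⟨i1, i2, ?_⟩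
  have hψ := fun w => GrowthDeriv.comp_coneMap (w := w) (σ := σ) hr hφ
  -- `hT` is the function T of `field_algebra`, of exponent -1. `hG` below gives the spatial
  -- components u_i T + c_i ψ/|y| of the vector field.
  have hT := fun w : Event => (hψ w).mul ((GrowthDeriv.sub (d := 1)
    (((GrowthDeriv.clm_snd P).sub (GrowthDeriv.bilin_velocity hr Q)).const_mul σ)
    (GrowthDeriv.norm_snd.mul (GrowthDeriv.velocity hr P))).mul
    (GrowthDeriv.inv_norm_snd.mul (GrowthDeriv.inv_retarded_norm hr hsub hσ)))
  have hG := fun i : Fin 3 =>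
    (((GrowthDeriv.velocity hr (EuclideanSpace.proj i)).mul
      (hT (0, EuclideanSpace.single i 1))).mono (d₂ := -1) (by norm_num)).add
    ((((GrowthDeriv.const (P (EuclideanSpace.single i 1))).sub
      (GrowthDeriv.velocity hr (Q (EuclideanSpace.single i 1)))).mul
      (GrowthDeriv.inv_norm_snd.mul (hψ _))).mono (by norm_num))
  rw [← sub_eq_zero, ← integral_sub i1 i2]
  refine integral_divergence (((hT (1, 0)).mono (by norm_num)).integrable_and_integral_eq_zero (A := A) ?_)
    (fun i => (hG i).integrable_and_integral_eq_zero (A := A) ?_) ?_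
  · intro q hq
    simp [hz q hq]
  · intro q hq
    simp [hz q hq]
  · intro q hq
    have h0 := norm_ne_zero_iff.2 hq
    have hk := (GrowthDeriv.retarded_norm_pos hr hsub hσ hq).ne'
    set D := fderiv ℝ φ (coneMap σ r q) with hD
    set u := deriv r q.1 with hu
    set a := deriv (deriv r) q.1
    set k := ‖q.2‖ - σ * inner ℝ q.2 u with hkdef
    have alg := field_algebra hσ h0 hk hkdef (N := P q.2 - Q q.2 u) (Pu := P u) (Pa := P a)
      (Qya := Q q.2 a) (ya := inner ℝ q.2 a) (uu := ‖u‖ ^ 2) (Dt := D (1, 0)) (Du := D (0, u))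
      (ψ := φ (coneMap σ r q)) (Z := ∑ i : Fin 3, D (0, EuclideanSpace.single i 1) *
        (P (EuclideanSpace.single i 1) - Q (EuclideanSpace.single i 1) u))
    -- These expansions in coordinates collapse the sums over i to the scalars of `field_algebra`.
    -- The hypothesis `hQ` enters as Q(u, u) = 0.
    have H1 := sum_apply_single (D.comp (ContinuousLinearMap.inr ℝ ℝ Space)) u
    have H2 := sum_mul_eq_inner q.2 u
    have H3 := sum_apply_single P u
    have H3' := sum_apply_single (Q.flip u) u
    have H4 := sum_mul_eq_inner u u
    have H5 := sum_apply_single P q.2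
    have H5' := sum_apply_single (Q.flip u) q.2
    rw [real_inner_self_eq_norm_sq] at H4
    simp only [ContinuousLinearMap.flip_apply, hQ, ContinuousLinearMap.comp_apply,
      ContinuousLinearMap.inr_apply, Fin.sum_univ_three] at H1 H2 H3 H3' H4 H5 H5' alg
    have e1 : ∀ i, D (coneDeriv σ r q (0, EuclideanSpace.single i 1)) =
        σ * ‖q.2‖⁻¹ * q.2 i * D (1, 0) + D (0, EuclideanSpace.single i 1) := fun i => by
      have : inner ℝ q.2 (EuclideanSpace.single i (1 : ℝ)) = q.2 i := by
        simp [EuclideanSpace.inner_single_right]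
      rw [coneDeriv_apply, hD, fderiv_prod_apply, this]
      simp
    have e2 : D (coneDeriv σ r q (1, 0)) = D (1, 0) + D (0, u) := by
      rw [coneDeriv_apply, hD, fderiv_prod_apply]
      simp [hu]
    simp only [contractedDeriv, fieldComp, Fin.sum_univ_three, e1, e2, ← hD, ← hkdef,
      inner_zero_right, inner_zero_left, map_zero, PiLp.proj_apply,
      EuclideanSpace.inner_single_left, EuclideanSpace.inner_single_right, map_one, one_mul,
      zero_mul, zero_apply, conj_trivial, mul_zero]
    linear_combination -alg - (σ * (P q.2 - Q q.2 u) - ‖q.2‖ * P u) * (‖q.2‖⁻¹ * k⁻¹) * H1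
      - (σ * ‖q.2‖⁻¹ * D (1, 0) * ((σ * (P q.2 - Q q.2 u) - ‖q.2‖ * P u) * (‖q.2‖⁻¹ * k⁻¹)) +
        φ (coneMap σ r q) * (-(‖q.2‖⁻¹ * P u) * ‖q.2‖⁻¹ * k⁻¹ +
        (σ * (P q.2 - Q q.2 u) - ‖q.2‖ * P u) * (-‖q.2‖⁻¹ * ‖q.2‖⁻¹ * ‖q.2‖⁻¹ * k⁻¹
          - ‖q.2‖⁻¹ * ‖q.2‖⁻¹ * k⁻¹ * k⁻¹))) * H2
      - φ (coneMap σ r q) * σ * ‖q.2‖⁻¹ * k⁻¹ * (H3 - H3')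
      - φ (coneMap σ r q) * (σ * (P q.2 - Q q.2 u) - ‖q.2‖ * P u) * ‖q.2‖⁻¹ * σ * k⁻¹ * k⁻¹ * H4
      - (-‖q.2‖⁻¹ * ‖q.2‖⁻¹ * ‖q.2‖⁻¹ * φ (coneMap σ r q) + ‖q.2‖⁻¹ * σ * ‖q.2‖⁻¹ * D (1, 0)) *
        (H5 - H5')

end

/-! ### Radial integration along the light cone. -/

section

/-- Integration in polar coordinates of three-space. -/
theorem integral_polar {f : Space → ℝ} (hf : Integrable f) :
    ∫ y, f y = ∫ η, (∫ t in Ioi (0 : ℝ), t ^ 2 * f (t • (η : Space)))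
      ∂(volume : Measure Space).toSphere := by
  have hmp := (volume : Measure Space).measurePreserving_homeomorphUnitSphereProd
  rw [finrank_space] at hmp
  have hemb := (homeomorphUnitSphereProd Space).measurableEmbedding
  set g : Metric.sphere (0 : Space) 1 × Ioi (0 : ℝ) → ℝ := fun p => f (p.2.1 • p.1.1)
  have hg : ∀ x : ({0}ᶜ : Set Space), g (homeomorphUnitSphereProd Space x) = f (x : Space) := fun x => by
    have := congrArg Subtype.val ((homeomorphUnitSphereProd Space).symm_apply_apply x)
    rw [homeomorphUnitSphereProd_symm_apply_coe] at this
    simp only [g, this]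
  have hfi : Integrable (fun x : ({0}ᶜ : Set Space) => f (x : Space))
      ((volume : Measure Space).comap (↑)) := by
    have : IntegrableOn f ({0}ᶜ : Set Space) := hf.integrableOn
    rwa [integrableOn_iff_comap_subtypeVal (measurableSet_singleton _).compl] at this
  have hgi : Integrable g ((volume : Measure Space).toSphere.prod (Measure.volumeIoiPow 2)) := by
    rw [← hmp.integrable_comp_emb hemb]
    exact hfi.congr (Eventually.of_forall fun x => (hg x).symm)
  calc ∫ y, f y = ∫ x : ({0}ᶜ : Set Space), f (x : Space) ∂((volume : Measure Space).comap (↑)) := by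
        rw [integral_subtype_comap (measurableSet_singleton _).compl f, restrict_compl_singleton]
    _ = ∫ p, g p ∂((volume : Measure Space).toSphere.prod (Measure.volumeIoiPow 2)) := by
        rw [← hmp.integral_comp hemb]
        exact integral_congr_ae (Eventually.of_forall fun x => (hg x).symm)
    _ = _ := by
        rw [integral_prod _ hgi]
        refine integral_congr_ae (Eventually.of_forall fun η => ?_)
        simp only [Measure.volumeIoiPow, ENNReal.ofReal, g]
        rw [integral_withDensity_eq_integral_smul (by fun_prop),
          integral_subtype_comap measurableSet_Ioi
            fun t : ℝ => Real.toNNReal (t ^ 2) • f (t • (η : Space))]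
        refine setIntegral_congr_fun measurableSet_Ioi fun t _ => ?_
        simp only [NNReal.smul_def, smul_eq_mul, Real.coe_toNNReal _ (sq_nonneg t)]

theorem toSphere_real_univ : (volume : Measure Space).toSphere.real univ = 4 * Real.pi := by
  rw [Measure.toSphere_real_apply_univ, finrank_space, measureReal_def,
    EuclideanSpace.volume_ball_fin_three]
  simp only [ENNReal.ofReal_one, one_pow, one_mul, Nat.cast_ofNat]
  rw [ENNReal.toReal_ofReal (by positivity)]
  ring

variable {σ : ℝ} {r : ℝ → Space}

/-- The integral of the radial derivative along the light cone. -/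
theorem integral_radial {φ : Event → ℝ} (hφ : ContDiff ℝ 1 φ)
    (hc : HasCompactSupport φ) (s : ℝ)
    (hi : Integrable fun y : Space => ‖y‖⁻¹ * ‖y‖⁻¹ *
      fderiv ℝ φ (coneMap σ r (s, y)) (σ, ‖y‖⁻¹ • y)) :
    ∫ y : Space, ‖y‖⁻¹ * ‖y‖⁻¹ * fderiv ℝ φ (coneMap σ r (s, y)) (σ, ‖y‖⁻¹ • y) =
      -(4 * Real.pi) * φ (s, r s) := by
  rw [integral_polar hi]
  -- On each ray the weight t² cancels the two inverse norms. What remains is the derivative of φ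
  -- along a light ray, which integrates to minus its value at the vertex.
  have h : ∀ η : Metric.sphere (0 : Space) 1, ∫ t in Ioi (0 : ℝ), t ^ 2 * (‖t • (η : Space)‖⁻¹ *
      ‖t • (η : Space)‖⁻¹ * fderiv ℝ φ (coneMap σ r (s, t • (η : Space)))
        (σ, ‖t • (η : Space)‖⁻¹ • t • (η : Space))) = -φ (s, r s) := fun η => by
    have hn1 : ‖(η : Space)‖ = 1 := by simp
    set γ : ℝ → ℝ := fun t => φ (s + σ * t, r s + t • (η : Space)) with hγ
    have hγ1 : ContDiff ℝ 1 γ := by fun_prop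
    have hγc : HasCompactSupport γ := by
      obtain ⟨B, hB⟩ := hc.isCompact.isBounded.exists_norm_le
      refine HasCompactSupport.intro (isCompact_Icc (a := -(B + ‖r s‖)) (b := B + ‖r s‖))
        fun t ht => ?_
      by_contra h0
      have h1 := hB _ (subset_tsupport φ h0)
      have h2 : ‖r s + t • (η : Space)‖ ≤ B := (norm_snd_le _).trans h1
      have h3 : ‖t • (η : Space)‖ ≤ ‖r s + t • (η : Space)‖ + ‖r s‖ := by
        simpa using norm_sub_le (r s + t • (η : Space)) (r s)
      rw [norm_smul, hn1, mul_one, Real.norm_eq_abs] at h3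
      exact ht (abs_le.1 (by linarith))
    have hd : ∀ t, deriv γ t = fderiv ℝ φ (s + σ * t, r s + t • (η : Space)) (σ, (η : Space)) := by
      intro t
      have h1 : HasDerivAt (fun t : ℝ => ((s + σ * t, r s + t • (η : Space)) : Event))
          (σ, (η : Space)) t := by
        refine HasDerivAt.prodMk ?_ ?_
        · simpa using ((hasDerivAt_id t).const_mul σ).const_add s
        · simpa using ((hasDerivAt_id t).smul_const (η : Space)).const_add (r s)
      exact (((hφ.differentiable (by norm_num)).differentiableAt.hasFDerivAt).comp_hasDerivAt t
        h1).deriv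
    have := hγc.integral_Ioi_deriv_eq hγ1 0
    rw [show φ (s, r s) = γ 0 by simp [hγ], ← this]
    refine setIntegral_congr_fun measurableSet_Ioi fun t ht => ?_
    have ht0 : t ≠ 0 := (mem_Ioi.1 ht).ne'
    have hn : ‖t • (η : Space)‖ = t := by
      rw [norm_smul, hn1, mul_one, Real.norm_of_nonneg (mem_Ioi.1 ht).le]
    simp only [hd, coneMap, hn, smul_smul, inv_mul_cancel₀ ht0, one_smul]
    field_simp
  simp only [h]
  rw [integral_const, toSphere_real_univ]
  simp

end

/-! ### The half light cone as fundamental solution of the wave equation. -/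

section

theorem dir_zero : dir 0 = (1, 0) := rfl

theorem dir_succ (i : Fin 3) : dir i.succ = (0, EuclideanSpace.single i 1) := by
  fin_cases i <;> rfl

theorem contDiff_pd {φ : Event → ℝ} (hφ : ContDiff ℝ ∞ φ) (μ : Fin 4) : ContDiff ℝ ∞ (pd μ φ) :=
  (hφ.fderiv_right (m := ∞) (by norm_num)).clm_apply contDiff_const

theorem tsupport_pd_subset (φ : Event → ℝ) (μ : Fin 4) : tsupport (pd μ φ) ⊆ tsupport φ := by
  refine closure_minimal (fun z hz => ?_) (isClosed_tsupport φ)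
  by_contra h
  exact hz (by simp [pd, fderiv_eq_zero_of_notMem_tsupport h])

theorem IsTestFunction.pd {U : Set Event} {φ : Event → ℝ} (hφ : IsTestFunction U φ) (μ : Fin 4) :
    IsTestFunction U (pd μ φ) :=
  ⟨contDiff_pd hφ.1 μ, hφ.2.1.mono' ((subset_tsupport _).trans (tsupport_pd_subset φ μ)),
    (tsupport_pd_subset φ μ).trans hφ.2.2⟩

theorem pd_comm {φ : Event → ℝ} (hφ : ContDiff ℝ ∞ φ) (μ ν : Fin 4) (z : Event) :
    pd μ (pd ν φ) z = pd ν (pd μ φ) z := by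
  have hd : DifferentiableAt ℝ (fderiv ℝ φ) z :=
    ((hφ.fderiv_right (m := 1) (by norm_cast)).differentiable (by norm_num)).differentiableAt
  have h : ∀ v w : Event, fderiv ℝ (fun z => fderiv ℝ φ z v) z w = fderiv ℝ (fderiv ℝ φ) z w v := by
    intro v w
    rw [fderiv_clm_apply hd (differentiableAt_const v)]
    simp
  have hs : IsSymmSndFDerivAt ℝ φ z := hφ.contDiffAt.isSymmSndFDerivAt (by simp; norm_cast)
  unfold pd
  rw [h, h]
  exact hs _ _

variable {σ : ℝ} {r : ℝ → Space}

/-- Twice the pairing of a function with half of the light cone of the point of the trajectory at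
time `s`. -/
def coneMean (σ : ℝ) (r : ℝ → Space) (χ : Event → ℝ) (s : ℝ) : ℝ :=
  ∫ y : Space, ‖y‖⁻¹ * χ (coneMap σ r (s, y))

theorem exists_slice_bound {χ : Event → ℝ} (hc : HasCompactSupport χ) (s : ℝ) :
    ∃ A : ℝ, ∀ y, coneMap σ r (s, y) ∈ tsupport χ → ‖y‖ ≤ A := by
  obtain ⟨B, hB⟩ := hc.isCompact.isBounded.exists_norm_le
  refine ⟨B + ‖r s‖, fun y hy => ?_⟩
  have h2 : ‖r s + y‖ ≤ B := (norm_snd_le (coneMap σ r (s, y))).trans (hB _ hy)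
  have h3 : ‖y‖ ≤ ‖r s + y‖ + ‖r s‖ := by simpa using norm_sub_le (r s + y) (r s)
  linarith

theorem growth_inv_norm_mul (hr : ContDiff ℝ 2 r) {χ : Event → ℝ} (hχ : Continuous χ) :
    Growth (-1) fun q : Event => ‖q.2‖⁻¹ * χ (coneMap σ r q) :=
  Growth.inv_norm_snd.mul (Growth.of_continuous (hχ.comp (continuous_coneMap hr)))

theorem integrable_slice_coneMap (hr : ContDiff ℝ 2 r) {χ : Event → ℝ} (hχ : Continuous χ)
    (hc : HasCompactSupport χ) (s : ℝ) :
    Integrable fun y : Space => ‖y‖⁻¹ * χ (coneMap σ r (s, y)) := by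
  obtain ⟨A, hA⟩ := exists_slice_bound (σ := σ) (r := r) hc s
  refine ((growth_inv_norm_mul hr hχ).mono (by norm_num)).integrable_slice (A := A) fun y hy =>
    hA y ?_
  by_contra h
  simp [image_eq_zero_of_notMem_tsupport h] at hy

/-- The subtracted sum is the divergence in y of ρ⁻¹(∂_i φ - σ(y_i/ρ)∂_t φ), evaluated on the cone.
The second derivatives cancel, and only ρ⁻² times the derivative of φ along the light ray survives.
-/
theorem wave_algebra {σ ρ φt φtt : ℝ} {y φ₁ φ₂ φt₁ : Fin 3 → ℝ} (hσ : σ = 1 ∨ σ = -1) (hρ : ρ ≠ 0)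
    (H : ∑ i, y i * y i = ρ ^ 2) :
    ρ⁻¹ * (∑ i, φ₂ i - φtt) - ∑ i, (-(ρ⁻¹ * y i) * ρ⁻¹ * ρ⁻¹ * (φ₁ i - σ * (y i * ρ⁻¹ * φt)) +
      ρ⁻¹ * ((σ * ρ⁻¹ * y i * φt₁ i + φ₂ i) - σ * ((1 * ρ⁻¹ + y i * (-(ρ⁻¹ * y i) * ρ⁻¹ * ρ⁻¹)) * φt +
        y i * ρ⁻¹ * (σ * ρ⁻¹ * y i * φtt + φt₁ i)))) =
    ρ⁻¹ * ρ⁻¹ * (σ * φt + ρ⁻¹ * ∑ i, y i * φ₁ i) := by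
  have H' : ρ⁻¹ * ρ⁻¹ * (∑ i, y i * y i) = 1 := by rw [H]; field_simp
  have hs : σ * σ = 1 := by rcases hσ with rfl | rfl <;> norm_num
  simp only [Fin.sum_univ_three] at H' ⊢
  linear_combination (-2 * σ * ρ⁻¹ * ρ⁻¹ * φt + ρ⁻¹ * φtt) * H' + ρ⁻¹ * φtt *
    (ρ⁻¹ * ρ⁻¹ * (y 0 * y 0 + y 1 * y 1 + y 2 * y 2)) * hs

theorem integral_slice_divergence {F W : Space → ℝ} {G : Fin 3 → Space → ℝ} (hF : Integrable F)
    (hG : ∀ i, Integrable (G i) ∧ ∫ y, G i y = 0) (h : ∀ y, y ≠ 0 → F y - ∑ i, G i y = W y) :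
    Integrable W ∧ ∫ y, W y = ∫ y, F y := by
  have hae : (fun y => F y - ∑ i, G i y) =ᵐ[volume] W := by
    filter_upwards [ae_forall_add_smul_ne_zero 0] with y hy
    exact h y (by simpa using hy 0)
  have hs : Integrable fun y => ∑ i, G i y := integrable_finsetSum _ fun i _ => (hG i).1
  refine ⟨(hF.sub hs).congr hae, ?_⟩
  rw [← integral_congr_ae hae, integral_sub hF hs, integral_finsetSum _ fun i _ => (hG i).1]
  simp [(hG _).2]

/-- The fundamental solution of the wave equation. -/
theorem coneMean_wave (hr : ContDiff ℝ 2 r) (hσ : σ = 1 ∨ σ = -1) {φ : Event → ℝ}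
    (hφ : ContDiff ℝ ∞ φ) (hc : HasCompactSupport φ) (s : ℝ) :
    ∑ i : Fin 3, coneMean σ r (pd i.succ (pd i.succ φ)) s - coneMean σ r (pd 0 (pd 0 φ)) s =
      -(4 * Real.pi) * φ (s, r s) := by
  have hc1 := fun μ => hc.mono' ((subset_tsupport _).trans (tsupport_pd_subset φ μ))
  have hc2 := fun μ => (hc1 μ).mono'
    ((subset_tsupport _).trans (tsupport_pd_subset (pd μ φ) μ))
  have h1 := fun μ => contDiff_pd hφ μ
  have h2 := fun μ => contDiff_pd (h1 μ) μ
  have hint := fun μ => integrable_slice_coneMap (σ := σ) hr (h2 μ).continuous (hc2 μ) s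
  obtain ⟨A, hA⟩ := exists_slice_bound (σ := σ) (r := r) hc s
  have hG := fun i : Fin 3 => (GrowthDeriv.inv_norm_snd
    (w := (0, EuclideanSpace.single i 1))).mul
    ((GrowthDeriv.comp_coneMap (σ := σ) hr ((h1 i.succ).of_le (by norm_cast))).sub
      (((((GrowthDeriv.clm_snd (EuclideanSpace.proj i)).mul GrowthDeriv.inv_norm_snd).mul
        (GrowthDeriv.comp_coneMap (σ := σ) hr ((h1 0).of_le (by norm_cast)))).const_mul σ).mono
        (d₂ := 0) (by norm_num)))
  have hz : ∀ y, ¬ ‖y‖ ≤ A → ∀ μ, pd μ φ (coneMap σ r (s, y)) = 0 ∧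
      fderiv ℝ (pd μ φ) (coneMap σ r (s, y)) = 0 := fun y hy μ => by
    have h := fun h => hy (hA y (tsupport_pd_subset φ μ h))
    exact ⟨image_eq_zero_of_notMem_tsupport h, fderiv_eq_zero_of_notMem_tsupport h⟩
  have hI := fun i => ((hG i).mono (d₂ := -1)
      (by norm_num)).integrable_slice_and_integral_eq_zero (s := s) (A := A) (fun y hy => by
    simp [hz y hy])
  have hF : Integrable fun y : Space => ‖y‖⁻¹ *
      (∑ i : Fin 3, pd i.succ (pd i.succ φ) (coneMap σ r (s, y)) -
        pd 0 (pd 0 φ) (coneMap σ r (s, y))) := by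
    simp only [mul_sub, Finset.mul_sum]
    exact (integrable_finsetSum _ fun i _ => hint _).sub (hint 0)
  obtain ⟨hWi, hW⟩ := integral_slice_divergence (W := fun y => ‖y‖⁻¹ * ‖y‖⁻¹ *
    fderiv ℝ φ (coneMap σ r (s, y)) (σ, ‖y‖⁻¹ • y)) hF hI (fun y hy => by
      have e := wave_algebra (φt := pd 0 φ (coneMap σ r (s, y)))
        (φtt := pd 0 (pd 0 φ) (coneMap σ r (s, y))) (y := y)
        (φ₁ := fun i => pd i.succ φ (coneMap σ r (s, y)))
        (φ₂ := fun i => pd i.succ (pd i.succ φ) (coneMap σ r (s, y)))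
        (φt₁ := fun i => pd 0 (pd i.succ φ) (coneMap σ r (s, y))) hσ (norm_ne_zero_iff.2 hy)
        (by rw [sum_mul_eq_inner, real_inner_self_eq_norm_sq])
      have e1 : ∀ (χ : Event → ℝ) (i : Fin 3), fderiv ℝ χ (coneMap σ r (s, y))
          (coneDeriv σ r (s, y) (0, EuclideanSpace.single i 1)) =
          σ * ‖y‖⁻¹ * y i * pd 0 χ (coneMap σ r (s, y)) +
            pd i.succ χ (coneMap σ r (s, y)) := fun χ i => by
        have : inner ℝ y (EuclideanSpace.single i (1 : ℝ)) = y i := by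
          simp [EuclideanSpace.inner_single_right]
        rw [coneDeriv_apply, fderiv_prod_apply, this, pd, pd, dir_succ, dir_zero]
        simp
      have e2 : fderiv ℝ φ (coneMap σ r (s, y)) (σ, ‖y‖⁻¹ • y) =
          σ * pd 0 φ (coneMap σ r (s, y)) +
            ‖y‖⁻¹ * ∑ i : Fin 3, y i * pd i.succ φ (coneMap σ r (s, y)) := by
        have := sum_apply_single ((fderiv ℝ φ (coneMap σ r (s, y))).comp
          (ContinuousLinearMap.inr ℝ ℝ Space)) (‖y‖⁻¹ • y)
        rw [fderiv_prod_apply]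
        simp only [ContinuousLinearMap.comp_apply, ContinuousLinearMap.inr_apply] at this
        rw [← this]
        simp only [pd, dir_succ, dir_zero, Finset.mul_sum, PiLp.smul_apply, smul_eq_mul, mul_assoc]
      have e3 : ∀ i : Fin 3, inner ℝ y (EuclideanSpace.single i (1 : ℝ)) = y i := fun i => by
        simp [EuclideanSpace.inner_single_right]
      simp only [e2, e1, ← e, pd_comm hφ _ 0, e3, PiLp.proj_apply, PiLp.single_apply,
        if_true])
  rw [integral_radial (hφ.of_le (by norm_cast)) hc s hWi] at hW
  rw [hW]
  simp only [mul_sub, Finset.mul_sum, coneMean]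
  rw [integral_sub (integrable_finsetSum _ fun i _ => hint _) (hint 0),
    integral_finsetSum _ fun i _ => hint _]

end

/-! ### Integrals over the trajectory and return to space-time. -/

section

variable {σ : ℝ} {r : ℝ → Space}

theorem integrable_and_integral_of_slice {F : Event → ℝ} {f : ℝ → ℝ} (hF : Integrable F)
    (h : ∀ s, f s = ∫ y, F (s, y)) : Integrable f ∧ ∫ s, f s = ∫ q, F q := by
  have hf : f = fun s => ∫ y, F (s, y) := funext h
  rw [hf]
  exact ⟨Integrable.integral_prod_left hF, (integral_prod F hF).symm⟩

theorem integrable_mul_coneMean (hr : ContDiff ℝ 2 r) {χ : Event → ℝ} (hχ : Continuous χ) {A : ℝ}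
    (hA : ∀ q, coneMap σ r q ∈ tsupport χ → |q.1| ≤ A ∧ ‖q.2‖ ≤ A) {c : ℝ → ℝ}
    (hc : Continuous c) : Integrable fun s => c s * coneMean σ r χ s := by
  have hF : Integrable fun q : Event => c q.1 * (‖q.2‖⁻¹ * χ (coneMap σ r q)) := by
    refine Growth.integrable (A := A) (((Growth.of_continuous (f := fun q => c q.1)
      (by fun_prop)).mul (growth_inv_norm_mul hr hχ)).mono (by norm_num)) fun q hq => hA q ?_
    by_contra h
    simp [image_eq_zero_of_notMem_tsupport h] at hq
  exact (integrable_and_integral_of_slice hF fun s => by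
    simp only [coneMean, integral_const_mul]).1

/-- The derivative along the current of a function integrates to zero. -/
theorem integral_coneMean_current (hr : ContDiff ℝ 2 r) {χ : Event → ℝ} (hχ : ContDiff ℝ ∞ χ)
    (hc : HasCompactSupport χ) {A : ℝ}
    (hA : ∀ q, coneMap σ r q ∈ tsupport χ → |q.1| ≤ A ∧ ‖q.2‖ ≤ A) :
    Integrable (fun s => coneMean σ r (pd 0 χ) s +
      ∑ i : Fin 3, deriv r s i * coneMean σ r (pd i.succ χ) s) ∧
    ∫ s, (coneMean σ r (pd 0 χ) s +
      ∑ i : Fin 3, deriv r s i * coneMean σ r (pd i.succ χ) s) = 0 := by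
  -- At fixed y, ∂_s of χ in cone coordinates is ∂_t χ + u·∇χ. The integrand is therefore the
  -- s-derivative of χ/‖y‖.
  have hd := (GrowthDeriv.inv_norm_snd (w := (1, 0))).mul
    (GrowthDeriv.comp_coneMap (σ := σ) hr (hχ.of_le (by norm_cast)))
  obtain ⟨h1, h2⟩ := (hd.mono (d₂ := -1) (by norm_num)).integrable_and_integral_eq_zero (A := A)
    (fun q hq => by
      have h : coneMap σ r q ∉ tsupport χ := fun h => hq (hA q h)
      simp [image_eq_zero_of_notMem_tsupport h, fderiv_eq_zero_of_notMem_tsupport h])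
  have hint := fun μ s => integrable_slice_coneMap (σ := σ) hr (contDiff_pd hχ μ).continuous
    (hc.mono' ((subset_tsupport _).trans (tsupport_pd_subset χ μ))) s
  have := integrable_and_integral_of_slice (f := fun s => coneMean σ r (pd 0 χ) s +
      ∑ i : Fin 3, deriv r s i * coneMean σ r (pd i.succ χ) s) h1 fun s => by
    have e : ∀ y : Space, fderiv ℝ χ (coneMap σ r (s, y)) (coneDeriv σ r (s, y) (1, 0)) =
        pd 0 χ (coneMap σ r (s, y)) +
          ∑ i : Fin 3, deriv r s i * pd i.succ χ (coneMap σ r (s, y)) := fun y => by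
      have := sum_apply_single ((fderiv ℝ χ (coneMap σ r (s, y))).comp
        (ContinuousLinearMap.inr ℝ ℝ Space)) (deriv r s)
      simp only [ContinuousLinearMap.comp_apply, ContinuousLinearMap.inr_apply] at this
      rw [coneDeriv_apply, fderiv_prod_apply]
      simp [pd, dir_succ, dir_zero, this]
    simp only [e, inner_zero_right, mul_zero, neg_zero, zero_mul, zero_add, mul_add,
      Finset.mul_sum, mul_left_comm _ (deriv r s _)]
    rw [integral_add (hint 0 s) (integrable_finsetSum _ fun i _ => (hint _ s).const_mul _),
      integral_finsetSum _ fun i _ => (hint _ s).const_mul _]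
    simp only [integral_const_mul, coneMean]
  exact ⟨this.1, this.2.trans h2⟩

variable {U : Set Event} {τ : Event → ℝ}

/-- On the support of φ, uniqueness of the cone time makes z ↦ (τ z, z.2 - r(τ z)) the inverse of
the cone coordinates; elsewhere both integrands vanish. -/
theorem integrable_mul_fieldComp (hr : ContDiff ℝ 2 r) (hsub : ∀ t, ‖deriv r t‖ < 1)
    (hσ : σ = 1 ∨ σ = -1) (hU : IsOpen U) (hτ : ∀ z ∈ U, IsConeTime σ r z (τ z))
    (P : Space →L[ℝ] ℝ) (Q : Space →L[ℝ] Space →L[ℝ] ℝ) {φ : Event → ℝ} (hφ : Continuous φ)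
    (hc : HasCompactSupport φ) (hφU : tsupport φ ⊆ U) :
    Integrable (fun z => φ z * fieldComp σ P Q (z.2 - r (τ z)) (deriv r (τ z))
      (deriv (deriv r) (τ z))) ∧
    ∫ z, φ z * fieldComp σ P Q (z.2 - r (τ z)) (deriv r (τ z)) (deriv (deriv r) (τ z)) =
    ∫ q : Event, ‖q.2‖⁻¹ * (‖q.2‖ - σ * inner ℝ q.2 (deriv r q.1)) *
      (φ (coneMap σ r q) * fieldComp σ P Q q.2 (deriv r q.1) (deriv (deriv r) q.1)) := by
  obtain ⟨A, hA⟩ := exists_bound_of_coneMap_mem hr hsub hσ hU hτ hc hφU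
  have h := integral_comp_coneMap hr hsub hσ
    (G := fun z => φ z * fieldComp σ P Q (z.2 - r (τ z)) (deriv r (τ z)) (deriv (deriv r) (τ z)))
    (H := fun q : Event => ‖q.2‖⁻¹ * (‖q.2‖ - σ * inner ℝ q.2 (deriv r q.1)) *
      (φ (coneMap σ r q) * fieldComp σ P Q q.2 (deriv r q.1) (deriv (deriv r) q.1)))
    (fun z hz => by
      have : z ∉ tsupport φ := fun h => hz ⟨_, coneMap_of_isConeTime (hτ z (hφU h))⟩
      simp [image_eq_zero_of_notMem_tsupport this])
    (fun q hq => by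
      by_cases hm : coneMap σ r q ∈ tsupport φ
      · have e : τ (coneMap σ r q) = q.1 :=
          (hτ _ (hφU hm)).unique hr hsub hσ (isConeTime_coneMap q)
        have e' : (coneMap σ r q).2 - r q.1 = q.2 := by simp [coneMap]
        rw [e, e']
      · simp [image_eq_zero_of_notMem_tsupport hm])
  exact ⟨h.1.2 (integrable_field_coneMap hr hsub hσ P Q hφ hA), h.2⟩

/-- The field is the derivative of the potential. -/
theorem integral_field (hr : ContDiff ℝ 2 r) (hsub : ∀ t, ‖deriv r t‖ < 1)
    (hσ : σ = 1 ∨ σ = -1) (hU : IsOpen U) (hτ : ∀ z ∈ U, IsConeTime σ r z (τ z))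
    (P : Space →L[ℝ] ℝ) (Q : Space →L[ℝ] Space →L[ℝ] ℝ) (hQ : ∀ v, Q v v = 0)
    {φ : Event → ℝ} (hφ : IsTestFunction U φ) :
    Integrable (fun s => coneMean σ r (pd 0 φ) s * P (deriv r s) +
      ∑ i : Fin 3, coneMean σ r (pd i.succ φ) s *
        (P (EuclideanSpace.single i 1) - Q (EuclideanSpace.single i 1) (deriv r s))) ∧
    ∫ s, (coneMean σ r (pd 0 φ) s * P (deriv r s) +
      ∑ i : Fin 3, coneMean σ r (pd i.succ φ) s *
        (P (EuclideanSpace.single i 1) - Q (EuclideanSpace.single i 1) (deriv r s))) =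
    ∫ z, φ z * fieldComp σ P Q (z.2 - r (τ z)) (deriv r (τ z)) (deriv (deriv r) (τ z)) := by
  obtain ⟨A, hA⟩ := exists_bound_of_coneMap_mem hr hsub hσ hU hτ hφ.2.1 hφ.2.2
  obtain ⟨h1, -, h3⟩ := integral_field_coneMap hr hsub hσ P Q hQ (hφ.1.of_le (by norm_cast)) hA
  rw [(integrable_mul_fieldComp hr hsub hσ hU hτ P Q hφ.1.continuous hφ.2.1 hφ.2.2).2, ← h3]
  have hint := fun μ s => integrable_slice_coneMap (σ := σ) hr (hφ.pd μ).1.continuous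
    (hφ.pd μ).2.1 s
  refine integrable_and_integral_of_slice h1 fun s => ?_
  have e : ∀ y : Space, ‖y‖⁻¹ * contractedDeriv P Q φ (coneMap σ r (s, y)) (deriv r s) =
      ‖y‖⁻¹ * pd 0 φ (coneMap σ r (s, y)) * P (deriv r s) +
      ∑ i : Fin 3, ‖y‖⁻¹ * pd i.succ φ (coneMap σ r (s, y)) *
        (P (EuclideanSpace.single i 1) - Q (EuclideanSpace.single i 1) (deriv r s)) := fun y => by
    simp only [contractedDeriv, pd, dir_succ, dir_zero, mul_add, Finset.mul_sum, mul_assoc]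
  simp only [e]
  rw [integral_add ((hint 0 s).mul_const _)
      (integrable_finsetSum _ fun i _ => (hint _ s).mul_const _),
    integral_finsetSum _ fun i _ => (hint _ s).mul_const _]
  simp only [integral_mul_const, coneMean]

theorem continuousOn_fieldComp (hr : ContDiff ℝ 2 r) (hsub : ∀ t, ‖deriv r t‖ < 1)
    (hσ : σ = 1 ∨ σ = -1) (hU : IsOpen U) (hτ : ∀ z ∈ U, IsConeTime σ r z (τ z))
    (P : Space →L[ℝ] ℝ) (Q : Space →L[ℝ] Space →L[ℝ] ℝ) :
    ContinuousOn (fun z => fieldComp σ P Q (z.2 - r (τ z)) (deriv r (τ z))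
      (deriv (deriv r) (τ z))) {z | z ∈ U ∧ z.2 ≠ r z.1} := by
  have hrc := hr.continuous
  have ht : ContinuousOn τ {z | z ∈ U ∧ z.2 ≠ r z.1} :=
    (continuousOn_coneTime hr hsub hσ hU hτ).mono fun z hz => hz.1
  have h1 : ContinuousOn (fun z : Event => ((τ z, z.2 - r (τ z)) : Event))
      {z | z ∈ U ∧ z.2 ≠ r z.1} :=
    ht.prodMk (continuousOn_snd.sub (hrc.comp_continuousOn ht))
  have hm : MapsTo (fun z : Event => ((τ z, z.2 - r (τ z)) : Event))
      {z | z ∈ U ∧ z.2 ≠ r z.1} {q | q.2 ≠ 0} := fun z hz =>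
    isConeTime_sub_ne_zero (hτ z hz.1) hz.2
  have h2 := (growth_fieldComp hr hsub hσ P Q).cont.comp h1 hm
  simpa only [Function.comp_def] using h2

theorem locallyIntegrableOn_fieldComp (hr : ContDiff ℝ 2 r) (hsub : ∀ t, ‖deriv r t‖ < 1)
    (hσ : σ = 1 ∨ σ = -1) (hU : IsOpen U) (hτ : ∀ z ∈ U, IsConeTime σ r z (τ z))
    (P : Space →L[ℝ] ℝ) (Q : Space →L[ℝ] Space →L[ℝ] ℝ) :
    LocallyIntegrableOn (fun z => fieldComp σ P Q (z.2 - r (τ z)) (deriv r (τ z))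
      (deriv (deriv r) (τ z))) U := by
  rw [locallyIntegrableOn_iff hU.isLocallyClosed]
  intro K hKU hK
  obtain ⟨L, hL, hKL, hLU⟩ := exists_compact_between hK hU hKU
  -- A continuous cutoff equal to 1 on K and supported in U reduces local integrability to the
  -- integrability of the field times a compactly supported function.
  obtain ⟨f, hf1, hf0, hfc, -⟩ := exists_continuous_one_zero_of_isCompact hK
    isOpen_interior.isClosed_compl (disjoint_compl_right_iff_subset.2 hKL)
  have hs : tsupport f ⊆ U := by
    refine (closure_minimal (fun z hz => ?_) hL.isClosed).trans hLU
    by_contra h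
    exact hz (hf0 fun h' => h (interior_subset h'))
  have := (integrable_mul_fieldComp hr hsub hσ hU hτ P Q f.continuous hfc hs).1.integrableOn
    (s := K)
  refine this.congr_fun (fun z hz => ?_) hK.measurableSet
  simp [hf1 hz]

end

/-! ### Componentwise integrals and Clifford identities. -/

section

namespace HasIntegral

variable {α : Type*} [MeasurableSpace α] {μ : Measure α} {f g : α → Cl} {a b : Cl}

theorem add (hf : HasIntegral μ f a) (hg : HasIntegral μ g b) :
    HasIntegral μ (fun x => f x + g x) (a + b) := fun ℓ => by
  simp only [map_add]
  exact ⟨(hf ℓ).1.add (hg ℓ).1, by rw [integral_add (hf ℓ).1 (hg ℓ).1, (hf ℓ).2, (hg ℓ).2]⟩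

theorem map (hf : HasIntegral μ f a) (T : Cl →ₗ[ℝ] Cl) :
    HasIntegral μ (fun x => T (f x)) (T a) := fun ℓ => hf (ℓ ∘ₗ T)

theorem neg (hf : HasIntegral μ f a) : HasIntegral μ (fun x => -f x) (-a) :=
  hf.map (-LinearMap.id)

theorem const_smul (hf : HasIntegral μ f a) (c : ℝ) : HasIntegral μ (fun x => c • f x) (c • a) :=
  hf.map (c • LinearMap.id)

theorem mul_left (hf : HasIntegral μ f a) (c : Cl) : HasIntegral μ (fun x => c * f x) (c * a) :=
  hf.map (LinearMap.mulLeft ℝ c)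

theorem smul_const {f : α → ℝ} (hf : Integrable f μ) (c : Cl) :
    HasIntegral μ (fun x => f x • c) ((∫ x, f x ∂μ) • c) := fun ℓ => by
  simp only [map_smul, smul_eq_mul]
  exact ⟨hf.mul_const _, integral_mul_const _ _⟩

theorem sum {ι : Type*} (s : Finset ι) {f : ι → α → Cl} {a : ι → Cl}
    (h : ∀ i ∈ s, HasIntegral μ (f i) (a i)) :
    HasIntegral μ (fun x => ∑ i ∈ s, f i x) (∑ i ∈ s, a i) := fun ℓ => by
  simp only [map_sum]
  refine ⟨integrable_finsetSum _ fun i hi => (h i hi ℓ).1, ?_⟩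
  rw [integral_finsetSum _ fun i hi => (h i hi ℓ).1]
  exact Finset.sum_congr rfl fun i hi => (h i hi ℓ).2

theorem congr (hf : HasIntegral μ f a) (h : ∀ x, g x = f x) : HasIntegral μ g a := by
  rwa [funext h]

end HasIntegral

section Clifford

open CliffordAlgebra

theorem polar_minkowski (z w : Event) :
    QuadraticMap.polar minkowski z w = 2 * (-(z.1 * w.1) + inner ℝ z.2 w.2) := by
  rw [QuadraticMap.polar, minkowski_apply, minkowski_apply, minkowski_apply, Prod.fst_add,
    Prod.snd_add, norm_add_sq_real]
  ring

theorem ι_mul_ι_add (z w : Event) : ι minkowski z * ι minkowski w + ι minkowski w * ι minkowski z =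
    (2 * (-(z.1 * w.1) + inner ℝ z.2 w.2)) • (1 : Cl) := by
  rw [ι_mul_ι_add_swap, polar_minkowski, Algebra.algebraMap_eq_smul_one]

theorem bUp_eq (μ : Fin 4) : bUp μ = ι minkowski (metricDiag μ • dir μ) := by
  rw [map_smul]; rfl

theorem bUp_zero : bUp 0 = -bLow 0 := by simp [bUp, metricDiag]

theorem metricDiag_succ (i : Fin 3) : metricDiag i.succ = 1 := by
  fin_cases i <;> rfl

theorem bUp_succ (i : Fin 3) : bUp i.succ = vec (EuclideanSpace.single i 1) := by
  rw [bUp_eq, metricDiag_succ, one_smul, dir_succ, vec]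

theorem bUp_mul_bUp_add (μ ν : Fin 4) : bUp μ * bUp ν + bUp ν * bUp μ =
    (if μ = ν then 2 * metricDiag μ else 0) • (1 : Cl) := by
  rw [bUp_eq, bUp_eq, ι_mul_ι_add]
  congr 1
  fin_cases μ <;> fin_cases ν <;>
    simp [metricDiag, dir, EuclideanSpace.inner_single_left]

theorem bUp_anticomm {μ ν : Fin 4} (h : μ ≠ ν) : bUp ν * bUp μ = -(bUp μ * bUp ν) := by
  have := bUp_mul_bUp_add μ ν
  rw [if_neg h, zero_smul] at this
  exact (neg_eq_of_add_eq_zero_right this).symm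

/-- A basis vector commutes with itself and anticommutes with the other three factors of the
pseudoscalar. -/
theorem bUp_mul_im (μ : Fin 4) : bUp μ * im = -(im * bUp μ) := by
  have h : ∀ {μ ν : Fin 4}, μ ≠ ν → ∀ x, bUp ν * (bUp μ * x) = -(bUp μ * (bUp ν * x)) := by
    intro μ ν h x
    rw [← mul_assoc, bUp_anticomm h, neg_mul, mul_assoc]
  have a01 := @bUp_anticomm 0 1 (by decide)
  have a02 := @bUp_anticomm 0 2 (by decide)
  have a03 := @bUp_anticomm 0 3 (by decide)
  have a12 := @bUp_anticomm 1 2 (by decide)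
  have a13 := @bUp_anticomm 1 3 (by decide)
  have a23 := @bUp_anticomm 2 3 (by decide)
  have b01 := @h 0 1 (by decide)
  have b02 := @h 0 2 (by decide)
  have b03 := @h 0 3 (by decide)
  have b12 := @h 1 2 (by decide)
  have b13 := @h 1 3 (by decide)
  have b23 := @h 2 3 (by decide)
  fin_cases μ <;>
    simp only [im, mul_assoc, a03, a13, a23, b01, b02, b03, b12, b13, b23,
      mul_neg, neg_neg, Fin.zero_eta, Fin.mk_one, Fin.reduceFinMk]

theorem bUp_mul_charge (e m : ℝ) (μ : Fin 4) :
    bUp μ * (e • (1 : Cl) - m • im) = (e • (1 : Cl) + m • im) * bUp μ := by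
  rw [mul_sub, add_mul, mul_smul_comm, mul_smul_comm, bUp_mul_im, smul_mul_assoc, smul_mul_assoc,
    mul_one, one_mul, smul_neg, sub_neg_eq_add]

/-- The contravariant components of `b_0 + u`. -/
def flowCoord (r : ℝ → Space) (s : ℝ) : Fin 4 → ℝ := Fin.cons 1 fun i => deriv r s i

variable {r : ℝ → Space}

theorem flow_eq (s : ℝ) : flow r s = ι minkowski (1, deriv r s) := by
  rw [flow, bLow, vec, ← map_add, dir_zero]
  simp

/-- The wedge of two vectors is their product minus their scalar product, and b^ν·(b_0 + u) is the
ν-th contravariant coordinate of the flow. -/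
theorem bUp_mul_wedge (μ ν : Fin 4) (s : ℝ) : bUp μ * wedge (bUp ν) (flow r s) =
    bUp μ * bUp ν * flow r s - flowCoord r s ν • bUp μ := by
  have h : bUp ν * flow r s + flow r s * bUp ν = (2 * flowCoord r s ν) • (1 : Cl) := by
    rw [bUp_eq, flow_eq, ι_mul_ι_add]
    congr 1
    refine Fin.cases ?_ (fun i => ?_) ν
    · simp [metricDiag, dir_zero, flowCoord]
    · simp [metricDiag_succ, dir_succ, flowCoord, EuclideanSpace.inner_single_left]
  have h2 : wedge (bUp ν) (flow r s) = bUp ν * flow r s - flowCoord r s ν • (1 : Cl) := by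
    rw [wedge, eq_sub_of_add_eq' h]
    module
  rw [h2, mul_sub, mul_smul_comm, mul_one, mul_assoc]

/-- A symmetric matrix contracted with products of basis vectors is a scalar. -/
theorem sum_smul_bUp_mul_bUp {D : Fin 4 → Fin 4 → ℝ} (hD : ∀ μ ν, D μ ν = D ν μ) :
    ∑ μ, ∑ ν, D μ ν • (bUp μ * bUp ν) = (∑ μ, metricDiag μ * D μ μ) • (1 : Cl) := by
  have h1 : ∑ μ, ∑ ν, D μ ν • (bUp μ * bUp ν) = ∑ μ, ∑ ν, D μ ν • (bUp ν * bUp μ) := by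
    rw [Finset.sum_comm]
    exact Finset.sum_congr rfl fun μ _ => Finset.sum_congr rfl fun ν _ => by rw [hD]
  refine smul_right_injective _ (two_ne_zero (α := ℝ)) ?_
  simp only
  rw [two_smul]
  nth_rewrite 2 [h1]
  simp only [← Finset.sum_add_distrib, ← smul_add, bUp_mul_bUp_add, ite_smul, zero_smul,
    smul_ite, smul_zero, Finset.sum_ite_eq, Finset.mem_univ, if_true, Finset.sum_smul,
    Finset.smul_sum, smul_smul]
  refine Finset.sum_congr rfl fun μ _ => ?_
  congr 1
  ring

/-- A spatial vector as a Clifford number, as a linear map. -/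
def vecLin : Space →ₗ[ℝ] Cl := ι minkowski ∘ₗ LinearMap.inr ℝ ℝ Space

/-- The exterior product as a bilinear map. -/
def wedgeLin : Cl →ₗ[ℝ] Cl →ₗ[ℝ] Cl :=
  (1 / 2 : ℝ) • (LinearMap.mul ℝ Cl - (LinearMap.mul ℝ Cl).flip)

theorem wedgeLin_apply (a b : Cl) : wedgeLin a b = wedge a b := rfl

theorem vecLin_apply (v : Space) : vecLin v = vec v := rfl

/-- The component of `v ∧ b⁰`. -/
def electricComp (L : Module.Dual ℝ Cl) : Space →L[ℝ] ℝ :=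
  LinearMap.toContinuousLinearMap (L ∘ₗ wedgeLin.flip (bUp 0) ∘ₗ vecLin)

/-- The component of `v ∧ w`. -/
def magneticComp (L : Module.Dual ℝ Cl) : Space →L[ℝ] Space →L[ℝ] ℝ :=
  LinearMap.toContinuousBilinearMap ((wedgeLin.compl₁₂ vecLin vecLin).compr₂ L)

theorem electricComp_apply (L : Module.Dual ℝ Cl) (v : Space) :
    electricComp L v = L (wedge (vec v) (bUp 0)) := rfl

theorem magneticComp_apply (L : Module.Dual ℝ Cl) (v w : Space) :
    magneticComp L v w = L (wedge (vec v) (vec w)) := rfl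

theorem magneticComp_self (L : Module.Dual ℝ Cl) (v : Space) : magneticComp L v v = 0 := by
  simp [magneticComp_apply, wedge]

theorem apply_retardedPart (L : Module.Dual ℝ Cl) (x : Space) (s : ℝ) :
    L (retardedPart r x s) = fieldComp 1 (electricComp L) (magneticComp L) (x - r s)
      (deriv r s) (deriv (deriv r) s) := by
  simp only [retardedPart, fieldComp]
  generalize x - r s = R
  simp only [map_sub, map_add, map_smul, smul_eq_mul, electricComp_apply,
    magneticComp_apply, one_mul]

theorem apply_advancedPart (L : Module.Dual ℝ Cl) (x : Space) (s : ℝ) :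
    L (advancedPart r x s) = fieldComp (-1) (electricComp L) (magneticComp L) (x - r s)
      (deriv r s) (deriv (deriv r) s) := by
  simp only [advancedPart, fieldComp]
  generalize x - r s = R
  simp only [map_sub, map_add, map_smul, smul_eq_mul, electricComp_apply,
    magneticComp_apply, neg_mul, one_mul, sub_neg_eq_add]
  ring

theorem apply_wedge_bUp_zero_flow (L : Module.Dual ℝ Cl) (s : ℝ) :
    L (wedge (bUp 0) (flow r s)) = -electricComp L (deriv r s) := by
  rw [electricComp_apply, ← map_neg, bUp_zero, flow]
  congr 1
  simp only [wedge, mul_add, add_mul, mul_neg, neg_mul]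
  module

theorem apply_wedge_bUp_succ_flow (L : Module.Dual ℝ Cl) (i : Fin 3) (s : ℝ) :
    L (wedge (bUp i.succ) (flow r s)) = -electricComp L (EuclideanSpace.single i 1) +
      magneticComp L (EuclideanSpace.single i 1) (deriv r s) := by
  rw [electricComp_apply, magneticComp_apply, ← map_neg, ← map_add, bUp_zero, flow, bUp_succ]
  congr 1
  simp only [wedge, mul_add, add_mul, mul_neg, neg_mul]
  module

end Clifford

end

/-! ### Source pairing, field pairing and Maxwell equation. -/

section

variable {r : ℝ → Space}

/-- The pairing with both halves of the light cone. -/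
def fullMean (r : ℝ → Space) (χ : Event → ℝ) (s : ℝ) : ℝ :=
  coneMean 1 r χ s + coneMean (-1) r χ s

theorem pd_comp_const_sub {φ : Event → ℝ} (hφ : ContDiff ℝ ∞ φ) (μ : Fin 4) (x z : Event) :
    pd μ (fun y => φ (x - y)) z = -pd μ φ (x - z) := by
  have h := ((hφ.differentiable (by simp)).differentiableAt (x := x - z)).hasFDerivAt.comp z
    ((hasFDerivAt_id z).const_sub x)
  have h' : HasFDerivAt (fun y => φ (x - y)) _ z := h
  rw [pd, h'.fderiv]
  simp [pd]

/-- The minus sign comes from differentiating φ(x - ·), the half from 1/(2|x|). Reflecting y to -y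
turns the argument into the cone coordinates for both signs. -/
theorem deltaCone_pd (hr : ContDiff ℝ 2 r) {φ : Event → ℝ} (hφ : ContDiff ℝ ∞ φ)
    (hc : HasCompactSupport φ) (μ : Fin 4) (s : ℝ) :
    deltaCone (pd μ fun y => φ ((s, r s) - y)) = -(1 / 2) * fullMean r (pd μ φ) s := by
  have hi := fun σ => integrable_slice_coneMap (σ := σ) hr (contDiff_pd hφ μ).continuous
    (hc.mono' ((subset_tsupport _).trans (tsupport_pd_subset φ μ))) s
  rw [deltaCone, fullMean, coneMean, coneMean, ← integral_add (hi 1) (hi (-1)),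
    ← integral_const_mul, ← integral_neg_eq_self]
  refine integral_congr_ae (Eventually.of_forall fun y => ?_)
  simp only [pd_comp_const_sub hφ, coneMap, norm_neg, Prod.mk_sub_mk, sub_neg_eq_add, one_mul,
    neg_mul, ← sub_eq_add_neg, mul_inv]
  ring

theorem sourceAt_eq (hr : ContDiff ℝ 2 r) {φ : Event → ℝ} (hφ : ContDiff ℝ ∞ φ)
    (hc : HasCompactSupport φ) (s : ℝ) :
    sourceAt φ (s, r s) = ∑ μ, (-(1 / 2) * fullMean r (pd μ φ) s) • bUp μ := by
  simp only [sourceAt, source, deltaCone_pd hr hφ hc]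

theorem source_integrand_eq (e m : ℝ) (S J : Cl) :
    wedge S (e • J) - im * wedge S (m • J) = (e • (1 : Cl) - m • im) * wedge S J := by
  have h : ∀ c : ℝ, wedge S (c • J) = c • wedge S J := fun c => by
    rw [← wedgeLin_apply, map_smul, wedgeLin_apply]
  rw [h, h, sub_mul, smul_mul_assoc, smul_mul_assoc, one_mul, mul_smul_comm]

theorem source_integrand_expand (e m : ℝ) (hr : ContDiff ℝ 2 r) {φ : Event → ℝ}
    (hφ : ContDiff ℝ ∞ φ) (hc : HasCompactSupport φ) (s : ℝ) :
    wedge (sourceAt φ (s, r s)) (e • flow r s) - im * wedge (sourceAt φ (s, r s)) (m • flow r s) =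
      ∑ μ, (-(1 / 2) * fullMean r (pd μ φ) s) •
        ((e • (1 : Cl) - m • im) * wedge (bUp μ) (flow r s)) := by
  rw [source_integrand_eq, sourceAt_eq hr hφ hc, ← wedgeLin_apply, map_sum, LinearMap.sum_apply,
    Finset.mul_sum]
  refine Finset.sum_congr rfl fun μ _ => ?_
  rw [map_smul, LinearMap.smul_apply, wedgeLin_apply, mul_smul_comm]

variable {U : Set Event} {tr ta : Event → ℝ}

/-- A component of the dyon field. -/
theorem apply_dyonField (e m : ℝ) (ℓ : Module.Dual ℝ Cl) :
    ∃ L : Module.Dual ℝ Cl, (∀ x, L x = ℓ ((1 / 2 : ℝ) • ((e • (1 : Cl) - m • im) * x))) ∧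
      ∀ z, ℓ (dyonField e m r tr ta z) =
        fieldComp 1 (electricComp L) (magneticComp L) (z.2 - r (tr z)) (deriv r (tr z))
          (deriv (deriv r) (tr z)) +
        fieldComp (-1) (electricComp L) (magneticComp L) (z.2 - r (ta z)) (deriv r (ta z))
          (deriv (deriv r) (ta z)) := by
  refine ⟨ℓ ∘ₗ ((1 / 2 : ℝ) • LinearMap.mulLeft ℝ (e • (1 : Cl) - m • im)), fun x => rfl,
    fun z => ?_⟩
  rw [← apply_retardedPart, ← apply_advancedPart, ← map_add]
  rfl

theorem continuous_flowCoord (hr : ContDiff ℝ 2 r) (μ : Fin 4) :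
    Continuous fun s => flowCoord r s μ := by
  have h1 := hr.continuous_deriv (by norm_num)
  refine Fin.cases ?_ (fun i => ?_) μ
  · simpa [flowCoord] using continuous_const
  · simp only [flowCoord, Fin.cons_succ]
    fun_prop

theorem flow_eq_sum (s : ℝ) : flow r s = ∑ μ, flowCoord r s μ • bLow μ := by
  have hu : deriv r s = ∑ j, deriv r s j • EuclideanSpace.single j (1 : ℝ) := by
    simpa using ((EuclideanSpace.basisFun (Fin 3) ℝ).sum_repr (deriv r s)).symm
  have h : ∀ i : Fin 3, bLow i.succ = vecLin (EuclideanSpace.single i 1) := fun i => by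
    rw [bLow, dir_succ]; rfl
  rw [Fin.sum_univ_succ, flow, ← vecLin_apply]
  conv_lhs => rw [hu]
  simp [flowCoord, h, map_sum]

section Pairings

variable (hr : ContDiff ℝ 2 r) (hsub : ∀ t, ‖deriv r t‖ < 1) (hU : IsOpen U)
  (htr : ∀ z ∈ U, IsConeTime 1 r z (tr z)) (hta : ∀ z ∈ U, IsConeTime (-1) r z (ta z))
  {φ : Event → ℝ} (hφ : IsTestFunction U φ)

include hr hsub hU htr hta hφ

theorem integrable_mul_fullMean {c : ℝ → ℝ} (hc : Continuous c) :
    Integrable fun s => c s * fullMean r φ s := by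
  obtain ⟨A, hA⟩ := exists_bound_of_coneMap_mem hr hsub (.inl rfl) hU htr hφ.2.1 hφ.2.2
  obtain ⟨B, hB⟩ := exists_bound_of_coneMap_mem hr hsub (.inr rfl) hU hta hφ.2.1 hφ.2.2
  simp only [fullMean, mul_add]
  exact (integrable_mul_coneMean hr hφ.1.continuous hA hc).add
    (integrable_mul_coneMean hr hφ.1.continuous hB hc)

theorem integral_fullMean_current :
    Integrable (fun s => ∑ μ, flowCoord r s μ * fullMean r (pd μ φ) s) ∧
    ∫ s, ∑ μ, flowCoord r s μ * fullMean r (pd μ φ) s = 0 := by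
  obtain ⟨A, hA⟩ := exists_bound_of_coneMap_mem hr hsub (.inl rfl) hU htr hφ.2.1 hφ.2.2
  obtain ⟨B, hB⟩ := exists_bound_of_coneMap_mem hr hsub (.inr rfl) hU hta hφ.2.1 hφ.2.2
  obtain ⟨a1, a2⟩ := integral_coneMean_current hr hφ.1 hφ.2.1 hA
  obtain ⟨b1, b2⟩ := integral_coneMean_current hr hφ.1 hφ.2.1 hB
  have e : (fun s => ∑ μ, flowCoord r s μ * fullMean r (pd μ φ) s) = fun s =>
      (coneMean 1 r (pd 0 φ) s + ∑ i : Fin 3, deriv r s i * coneMean 1 r (pd i.succ φ) s) +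
      (coneMean (-1) r (pd 0 φ) s +
        ∑ i : Fin 3, deriv r s i * coneMean (-1) r (pd i.succ φ) s) := by
    funext s
    rw [Fin.sum_univ_succ]
    simp only [flowCoord, Fin.cons_zero, Fin.cons_succ, fullMean, mul_add, Finset.sum_add_distrib]
    ring
  rw [e]
  exact ⟨a1.add b1, by rw [integral_add a1 b1, a2, b2, add_zero]⟩

/-- A single Clifford number must serve all linear components. Expanding the flow in the basis makes
the integrand a finite sum of integrable real functions times constant Clifford numbers. -/
theorem exists_source_pairing (e m : ℝ) : ∃ a, IsSourceFieldPairing e m r φ a := by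
  have h : ∀ μ ν, Integrable fun s => flowCoord r s ν * fullMean r (pd μ φ) s := fun μ ν =>
    integrable_mul_fullMean hr hsub hU htr hta (hφ.pd μ) (continuous_flowCoord hr ν)
  refine ⟨_, (HasIntegral.sum Finset.univ fun μ _ => HasIntegral.sum Finset.univ fun ν _ =>
    HasIntegral.smul_const (h μ ν)
      ((-(1 / 2) : ℝ) • ((e • (1 : Cl) - m • im) * wedge (bUp μ) (bLow ν)))).congr fun s => ?_⟩
  rw [source_integrand_expand e m hr hφ.1 hφ.2.1]
  refine Finset.sum_congr rfl fun μ _ => ?_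
  rw [flow_eq_sum, ← wedgeLin_apply, map_sum, Finset.mul_sum, Finset.smul_sum]
  refine Finset.sum_congr rfl fun ν _ => ?_
  rw [map_smul, wedgeLin_apply, mul_smul_comm, smul_smul, smul_smul]
  congr 1
  ring

theorem field_pairing (e m : ℝ) : ∃ a, IsSourceFieldPairing e m r φ a ∧
    HasIntegral volume (fun z => φ z • dyonField e m r tr ta z) a := by
  obtain ⟨a, ha⟩ := exists_source_pairing hr hsub hU htr hta hφ e m
  refine ⟨a, ha, fun ℓ => ?_⟩
  obtain ⟨L, hL, hF⟩ := apply_dyonField (r := r) (tr := tr) (ta := ta) e m ℓ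
  have i1 := integrable_mul_fieldComp hr hsub (.inl rfl) hU htr (electricComp L) (magneticComp L)
    hφ.1.continuous hφ.2.1 hφ.2.2
  have i2 := integrable_mul_fieldComp hr hsub (.inr rfl) hU hta (electricComp L) (magneticComp L)
    hφ.1.continuous hφ.2.1 hφ.2.2
  obtain ⟨j1, k1⟩ := integral_field hr hsub (.inl rfl) hU htr (electricComp L) (magneticComp L)
    (magneticComp_self L) hφ
  obtain ⟨j2, k2⟩ := integral_field hr hsub (.inr rfl) hU hta (electricComp L) (magneticComp L)
    (magneticComp_self L) hφ
  simp only [map_smul, smul_eq_mul, hF, mul_add]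
  refine ⟨i1.1.add i2.1, ?_⟩
  rw [integral_add i1.1 i2.1, ← k1, ← k2, ← integral_add j1 j2, ← (ha ℓ).2]
  refine integral_congr_ae (Eventually.of_forall fun s => ?_)
  dsimp only
  rw [source_integrand_expand e m hr hφ.1 hφ.2.1, map_sum]
  have e : ∀ μ, ℓ ((-(1 / 2) * fullMean r (pd μ φ) s) •
      ((e • (1 : Cl) - m • im) * wedge (bUp μ) (flow r s))) =
      -(fullMean r (pd μ φ) s) * L (wedge (bUp μ) (flow r s)) := fun μ => by
    rw [hL, map_smul, map_smul, smul_eq_mul, smul_eq_mul]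
    ring
  simp only [e]
  rw [Fin.sum_univ_succ (n := 3), apply_wedge_bUp_zero_flow]
  simp only [apply_wedge_bUp_succ_flow, fullMean, Fin.sum_univ_three]
  ring

/-- Applying `field_pairing` to each ∂_μ φ moves the Dirac derivative to the source side, where the
integrand over the trajectory can be computed for each s. -/
theorem maxwell_pairing (e m : ℝ) : ∃ d, IsCurrentPairing e m r φ d ∧
    IsDiracPairing (dyonField e m r tr ta) φ (-(4 * Real.pi) • d) := by
  choose a ha hF using fun μ => field_pairing hr hsub hU htr hta (hφ.pd μ) e m
  have h1 : IsDiracPairing (dyonField e m r tr ta) φ (-∑ μ, bUp μ * a μ) := by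
    refine ((HasIntegral.sum Finset.univ fun μ _ => (hF μ).mul_left (bUp μ)).neg).congr fun z => ?_
    simp only [mul_smul_comm]
  have h2 := (HasIntegral.sum Finset.univ fun μ _ => (ha μ).mul_left (bUp μ)).neg
  -- This is the scalar-product term b^ν·j of the wedge. It has integral zero, so half of it can be
  -- added to cancel that term pointwise.
  have h3 : HasIntegral volume (fun s => (e • (1 : Cl) + m • im) *
      ∑ μ, (∑ ν, flowCoord r s ν * fullMean r (pd ν (pd μ φ)) s) • bUp μ) 0 := by
    have h := fun μ => integral_fullMean_current hr hsub hU htr hta (hφ.pd μ)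
    have := (HasIntegral.sum Finset.univ fun μ _ =>
      HasIntegral.smul_const (h μ).1 (bUp μ)).mul_left (e • (1 : Cl) + m • im)
    simpa [(h _).2] using this
  have h4 := (h2.add (h3.const_smul (1 / 2))).const_smul (-(4 * Real.pi))⁻¹
  have hπ : -(4 * Real.pi) ≠ 0 := by simp [Real.pi_ne_zero]
  refine ⟨(-(4 * Real.pi))⁻¹ • -∑ μ, bUp μ * a μ, ?_, by rwa [smul_inv_smul₀ hπ]⟩
  have h5 : IsCurrentPairing e m r φ ((-(4 * Real.pi))⁻¹ •
      (-∑ μ, bUp μ * a μ + (1 / 2 : ℝ) • (0 : Cl))) := by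
    refine h4.congr fun s => ?_
    rw [eq_inv_smul_iff₀ hπ]
    have hsum : ∑ μ, bUp μ * (wedge (sourceAt (pd μ φ) (s, r s)) (e • flow r s) -
        im * wedge (sourceAt (pd μ φ) (s, r s)) (m • flow r s)) =
        (e • (1 : Cl) + m • im) * ∑ μ, ∑ ν, (-(1 / 2) * fullMean r (pd ν (pd μ φ)) s) •
          (bUp μ * wedge (bUp ν) (flow r s)) := by
      rw [Finset.mul_sum]
      refine Finset.sum_congr rfl fun μ _ => ?_
      rw [source_integrand_expand e m hr (hφ.pd μ).1 (hφ.pd μ).2.1, Finset.mul_sum, Finset.mul_sum]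
      refine Finset.sum_congr rfl fun ν _ => ?_
      rw [mul_smul_comm, ← mul_assoc, bUp_mul_charge, mul_smul_comm, mul_assoc]
    -- Each half cone contributes -4π through the wave equation. The factor -1/2 of the source turns
    -- the total -8π into 4π.
    have hD : ∑ μ, ∑ ν, fullMean r (pd ν (pd μ φ)) s • (bUp μ * bUp ν) =
        (-(8 * Real.pi) * φ (s, r s)) • (1 : Cl) := by
      rw [sum_smul_bUp_mul_bUp fun μ ν => by rw [funext (pd_comm hφ.1 μ ν)]]
      congr 1
      have w1 := coneMean_wave hr (.inl rfl) hφ.1 hφ.2.1 s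
      have w2 := coneMean_wave hr (.inr rfl) hφ.1 hφ.2.1 s
      rw [Fin.sum_univ_succ]
      simp only [metricDiag_succ, one_mul, fullMean, Finset.sum_add_distrib]
      have : metricDiag 0 = -1 := rfl
      rw [this]
      linarith
    have hB : ∑ μ, ∑ ν, (-(1 / 2) * fullMean r (pd ν (pd μ φ)) s) •
        (bUp μ * wedge (bUp ν) (flow r s)) = (4 * Real.pi * φ (s, r s)) • flow r s +
        (1 / 2 : ℝ) • ∑ μ, (∑ ν, flowCoord r s ν * fullMean r (pd ν (pd μ φ)) s) • bUp μ := by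
      have : (4 * Real.pi * φ (s, r s)) • flow r s = (-(1 / 2) : ℝ) •
          ((∑ μ, ∑ ν, fullMean r (pd ν (pd μ φ)) s • (bUp μ * bUp ν)) * flow r s) := by
        rw [hD, smul_mul_assoc, one_mul, smul_smul]
        congr 1
        ring
      rw [this]
      simp only [Finset.sum_mul, Finset.smul_sum, Finset.sum_smul, ← Finset.sum_add_distrib,
        bUp_mul_wedge, smul_mul_assoc]
      refine Finset.sum_congr rfl fun μ _ => Finset.sum_congr rfl fun ν _ => ?_
      module
    rw [hsum, hB]
    simp only [mul_add, mul_smul_comm]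
    module
  simpa using h5

end Pairings

end

end Dyon

end

theorem mainTheorem3 (e m : ℝ) (r : ℝ → Dyon.Space) (hr : ContDiff ℝ 2 r)
    (hsub : ∀ t, ‖deriv r t‖ < 1) (tr ta : Dyon.Event → ℝ)
    (htr : ∀ z ∈ Dyon.domain r, Dyon.IsRetardedTime r z (tr z))
    (hta : ∀ z ∈ Dyon.domain r, Dyon.IsAdvancedTime r z (ta z)) :
    -- the retarded and advanced times are unique, and defined on an open set of events,
    -- which is everything if the speed stays away from that of light
    (∀ z s, z ∈ Dyon.domain r → Dyon.IsRetardedTime r z s → s = tr z) ∧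
    (∀ z s, z ∈ Dyon.domain r → Dyon.IsAdvancedTime r z s → s = ta z) ∧
    IsOpen (Dyon.domain r) ∧
    ((∃ κ : ℝ, κ < 1 ∧ ∀ t, ‖deriv r t‖ ≤ κ) → Dyon.domain r = Set.univ) ∧
    -- the explicit field is continuous off the world line and locally integrable
    (∀ ℓ : Module.Dual ℝ Dyon.Cl,
      ContinuousOn (fun z => ℓ (Dyon.dyonField e m r tr ta z))
        {z | z ∈ Dyon.domain r ∧ z.2 ≠ r z.1} ∧
      LocallyIntegrableOn (fun z => ℓ (Dyon.dyonField e m r tr ta z))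
        (Dyon.domain r) volume) ∧
    -- it is the field produced by the source function, and it solves the Maxwell equation
    ∀ φ : Dyon.Event → ℝ, Dyon.IsTestFunction (Dyon.domain r) φ →
      (∃ a : Dyon.Cl, Dyon.IsSourceFieldPairing e m r φ a ∧
        Dyon.HasIntegral volume (fun z => φ z • Dyon.dyonField e m r tr ta z) a) ∧
      (∃ d : Dyon.Cl, Dyon.IsCurrentPairing e m r φ d ∧
        Dyon.IsDiracPairing (Dyon.dyonField e m r tr ta) φ (-(4 * Real.pi) • d)) := by
  simp only [Dyon.isRetardedTime_iff, Dyon.isAdvancedTime_iff] at htr hta ⊢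
  have hdom : Dyon.domain r =
      {z | ∃ s, Dyon.IsConeTime 1 r z s} ∩ {z | ∃ s, Dyon.IsConeTime (-1) r z s} := by
    ext z
    simp [Dyon.domain, Dyon.isRetardedTime_iff, Dyon.isAdvancedTime_iff]
  have hU : IsOpen (Dyon.domain r) := by
    rw [hdom]
    exact (Dyon.isOpen_setOf_exists_isConeTime hr hsub (.inl rfl)).inter
      (Dyon.isOpen_setOf_exists_isConeTime hr hsub (.inr rfl))
  refine ⟨fun z s hz hs => hs.unique hr hsub (.inl rfl) (htr z hz),
    fun z s hz hs => hs.unique hr hsub (.inr rfl) (hta z hz), hU, ?_, fun ℓ => ?_,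
    fun φ hφ => ⟨Dyon.field_pairing hr hsub hU htr hta hφ e m,
      Dyon.maxwell_pairing hr hsub hU htr hta hφ e m⟩⟩
  · rintro ⟨κ, hκ, h⟩
    rw [hdom, Set.eq_univ_iff_forall]
    exact fun z => ⟨Dyon.exists_isConeTime_of_le hr (.inl rfl) hκ h z,
      Dyon.exists_isConeTime_of_le hr (.inr rfl) hκ h z⟩
  · obtain ⟨L, -, hF⟩ := Dyon.apply_dyonField (r := r) (tr := tr) (ta := ta) e m ℓ
    simp only [hF]
    exact ⟨(Dyon.continuousOn_fieldComp hr hsub (.inl rfl) hU htr _ _).add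
        (Dyon.continuousOn_fieldComp hr hsub (.inr rfl) hU hta _ _),
      (Dyon.locallyIntegrableOn_fieldComp hr hsub (.inl rfl) hU htr _ _).add
        (Dyon.locallyIntegrableOn_fieldComp hr hsub (.inr rfl) hU hta _ _)⟩
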